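/- All graphs are finite, simple and undirected. An edge-coloring of a graph $G$ (adjacent edges may receive the same color) makes $G$ conflict-free connected if every two distinct vertices are joined by a path on which some color is used on exactly one edge. For a connected graph $G$, the conflict-free connection number $\mathrm{cfc}(G)$ is the smallest number of colors in an edge-coloring that makes $G$ conflict-free connected. Write $\overline{G}$ for the complement of $G$ and $P_5$ for the path on five vertices. Theorem 5.1. Let $n \ge 4$. If $G$ is a graph of order $n$ such that $G$ and $\overline{G}$ are both connected, then $$4 \le \mathrm{cfc}(G)+\mathrm{cfc}(\overline{G}) \le n \quad\text{and}\quad 4 \le \mathrm{cfc}(G)\cdot \mathrm{cfc}(\overline{G}) \le 2(n-2).$$ Moreover: (i) Each of the two equalities $\mathrm{cfc}(G)+\mathrm{cfc}(\overline{G}) = n$ and $\mathrm{cfc}(G)\cdot\mathrm{cfc}(\overline{G}) = 2(n-2)$ holds if and only if at least one of $G$ and $\overline{G}$ is a tree with maximum degree $n-2$ or is isomorphic to $P_5$. (ii) The lower bounds are sharp: for every $n \ge 4$ there is a graph $G$ of order $n$, with $G$ and $\overline{G}$ both connected, such that $\mathrm{cfc}(G)+\mathrm{cfc}(\overline{G})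 = 4$ and $\mathrm{cfc}(G)\cdot\mathrm{cfc}(\overline{G}) = 4$. -/

import Mathlib

namespace SimpleGraph

variable {V : Type*} {G : SimpleGraph V}

/-- A walk is conflict-free for an edge-coloring `c` of `G` if some color is used on exactly one
of its edges. -/
def Walk.IsConflictFree {u v : V} (p : G.Walk u v) {K : Type*} (c : G.edgeSet → K) : Prop :=
  ∃ a : K, ∃! e : G.edgeSet, (e : Sym2 V) ∈ p.edges ∧ c e = a

/-- An edge-coloring `c` makes `G` conflict-free connected if every two distinct vertices are
joined by a conflict-free path. Adjacent edges may receive the same color. -/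
def IsConflictFreeConnected (G : SimpleGraph V) {K : Type*} (c : G.edgeSet → K) : Prop :=
  ∀ u v : V, u ≠ v → ∃ p : G.Walk u v, p.IsPath ∧ p.IsConflictFree c

/-- The conflict-free connection number: the smallest number `k` of colors for which some
edge-coloring with colors in `Fin k` makes `G` conflict-free connected. For a finite connected
graph such `k` exist, as an injective coloring shows. -/
noncomputable def cfcNumber (G : SimpleGraph V) : ℕ :=
  sInf {k : ℕ | ∃ c : G.edgeSet → Fin k, G.IsConflictFreeConnected c}

/-- `G` is a tree whose maximum degree is two less than its order, or `G` is the path on five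
vertices. -/
def IsNearStarOrP5 [Fintype V] (G : SimpleGraph V) [DecidableRel G.Adj] : Prop :=
  (G.IsTree ∧ G.maxDegree = Fintype.card V - 2) ∨ Nonempty (G ≃g pathGraph 5)

end SimpleGraph

namespace SimpleGraph

/-! The key fact is that, when a graph and its complement are connected on at least four vertices,
one of the two has conflict-free connection number 2 (`cfcNumber_eq_two_or_compl`). With `k` the
number of the other, the sum is `2 + k` and the product `2 * k`, so everything reduces to `2 ≤ k ≤ n
- 2` and to the graphs with `k = n - 2`.

For the key fact, suppose two colors do not suffice for the complement. A non-pendant bridge of `G`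
would make the complement contain a complete bipartite graph minus one edge, and two pendant
vertices of `G` would make one edge of the complement nearly dominating; two colors suffice in both
cases. So `G` has at most one bridge, and it is pendant. The rest is grown ear by ear with a set `S`
of marked edges, such that any two vertices are joined by a path avoiding `S` and any two distinct
ones by a path with exactly one marked edge (`IsFlexible.exists_extension`). Coloring by membership
in `S` uses two colors.

For `k ≤ n - 2`: no vertex is dominating, so there is a path on four vertices; two colors handle it,
and each further vertex costs at most one (`CFColorable.of_subset`). One more color is saved by a
five-vertex subgraph handled with two colors or a six-vertex one with three. Excluding such
subgraphs leaves only the extremal graphs (`cfColorable_of_not_isNearStarOrP5`). Conversely, those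
are trees, where paths are unique and `n - 2` colors are forced. -/

/-- Some value of `c` is attained exactly once on the list `l` (up to repetition in `l`). -/
def HasUniqueValue {α : Type*} (c : α → ℕ) (l : List α) : Prop :=
  ∃ e ∈ l, ∀ e' ∈ l, c e' = c e → e' = e

instance {α : Type*} [DecidableEq α] (c : α → ℕ) (l : List α) : Decidable (HasUniqueValue c l) :=
  inferInstanceAs (Decidable (∃ e ∈ l, ∀ e' ∈ l, c e' = c e → e' = e))

/-- Two vertices are joined, inside `U`, by a path with a uniquely coloured edge. -/
def LinkedIn {V : Type*} (G : SimpleGraph V) (c : Sym2 V → ℕ) (U : Set V) (u v : V) : Prop :=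
  ∃ p : G.Walk u v, p.IsPath ∧ (∀ x ∈ p.support, x ∈ U) ∧ HasUniqueValue c p.edges

/-! ### Extending a coloring from a vertex subset -/

section Basic

variable {V : Type*} {G : SimpleGraph V} {c : Sym2 V → ℕ} {U : Set V} {u v : V}

lemma LinkedIn.symm (h : G.LinkedIn c U u v) : G.LinkedIn c U v u := by
  obtain ⟨p, hp, hU, e, he, h'⟩ := h
  exact ⟨p.reverse, hp.reverse, by simpa using hU, e, by simpa using he, by simpa using h'⟩

lemma linkedIn_of_adj (h : G.Adj u v) (hu : u ∈ U) (hv : v ∈ U) : G.LinkedIn c U u v :=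
  ⟨h.toWalk, h.isPath_toWalk, by simp [hu, hv], s(u, v), by simp, by simp⟩

/-- There is an edge-coloring of `G` with `k` colors that makes it conflict-free connected. -/
def CFColorable (G : SimpleGraph V) (k : ℕ) : Prop :=
  ∃ c : G.edgeSet → Fin k, G.IsConflictFreeConnected c

lemma CFColorable.cfcNumber_le {k : ℕ} (h : G.CFColorable k) : G.cfcNumber ≤ k := Nat.sInf_le h

lemma CFColorable.cfColorable_cfcNumber {k : ℕ} (h : G.CFColorable k) :
    G.CFColorable G.cfcNumber :=
  Nat.sInf_mem (s := {k : ℕ | ∃ c : G.edgeSet → Fin k, G.IsConflictFreeConnected c}) ⟨k, h⟩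

/-- Bridge from `ℕ`-valued colorings of all pairs, which are easy to modify, to colorings of the
edge set in `Fin k`. -/
lemma CFColorable.of_linkedIn {k : ℕ} (c : Sym2 V → ℕ) (hc : ∀ e, c e < k)
    (h : ∀ u v, u ≠ v → G.LinkedIn c Set.univ u v) : G.CFColorable k := by
  refine ⟨fun e => ⟨c e, hc e⟩, fun u v huv => ?_⟩
  obtain ⟨p, hp, -, e, he, h'⟩ := h u v huv
  refine ⟨p, hp, ⟨c e, hc e⟩, ⟨e, p.edges_subset_edgeSet he⟩, ⟨he, rfl⟩, ?_⟩
  rintro ⟨e', he'⟩ ⟨hm, hce⟩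
  exact Subtype.ext (h' e' hm (by simpa using hce))

/-- Vertices can be added one at a time, each at the cost of one color. -/
lemma CFColorable.of_subset [Fintype V] (hG : G.Connected) {k : ℕ} (hc : ∀ e, c e < k)
    (hne : U.Nonempty) (h : ∀ u ∈ U, ∀ v ∈ U, u ≠ v → G.LinkedIn c U u v) :
    G.CFColorable (k + Uᶜ.ncard) := by
  induction hm : Uᶜ.ncard generalizing U k c with
  | zero =>
    have hU : U = Set.univ := by
      rw [Set.ncard_eq_zero (Set.toFinite _)] at hm
      exact Set.compl_empty_iff.mp hm
    subst hU
    exact .of_linkedIn c hc fun u v => h u trivial v trivial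
  | succ m ih =>
    classical
    obtain ⟨y, hy⟩ : Uᶜ.Nonempty := by
      rw [← Set.ncard_pos (Set.toFinite _)]; omega
    obtain ⟨x, hx⟩ := hne
    obtain ⟨⟨⟨a, b⟩, hab⟩, -, ha, hb⟩ := (hG x y).some.exists_boundary_dart U hx hy
    dsimp only at hab ha hb
    -- Every edge at `b` gets the new color `k`: a path from `b` to `a` continued inside `U` uses it
    -- exactly once, and paths inside `U` keep their colors.
    have key := ih (U := insert b U) (k := k + 1) (c := fun e => if b ∈ e then k else c e)
      (fun e => by split_ifs <;> [omega; exact (hc e).trans (by omega)]) ⟨b, by simp⟩ ?_ ?_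
    · rwa [show k + 1 + m = k + (m + 1) by ring] at key
    · have key : ∀ w ∈ U, G.LinkedIn (fun e => if b ∈ e then k else c e) (insert b U) b w := by
        intro w hw
        by_cases haw : a = w
        · subst haw
          exact linkedIn_of_adj hab.symm (by simp) (by simp [ha])
        · obtain ⟨p, hp, hpU, -⟩ := h a ha w hw haw
          have hbp : b ∉ p.support := fun hbp => hb (hpU b hbp)
          refine ⟨.cons hab.symm p, hp.cons hbp, ?_, s(b, a), by simp, ?_⟩
          · intro x hx
            rw [Walk.support_cons, List.mem_cons] at hx
            exact hx.imp id (hpU x)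
          · intro e he hce
            rw [Walk.edges_cons, List.mem_cons] at he
            refine he.resolve_right fun he => ?_
            have : b ∉ e := fun hbe => hbp (p.mem_support_of_mem_edges he hbe)
            simp only [this, if_false, Sym2.mem_iff, true_or, if_true] at hce
            exact (hc e).ne hce
      rintro u (rfl | hu) v (rfl | hv) huv
      · exact absurd rfl huv
      · exact key v hv
      · exact (key u hu).symm
      · obtain ⟨p, hp, hpU, e, he, h'⟩ := h u hu v hv huv
        have : ∀ e ∈ p.edges, b ∉ e := fun e he hbe =>
          hb (hpU b (p.mem_support_of_mem_edges he hbe))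
        refine ⟨p, hp, fun x hx => Or.inr (hpU x hx), e, he, fun e' he' hce => ?_⟩
        simp only [this e he, this e' he', if_false] at hce
        exact h' e' he' hce
    · rw [show (insert b U)ᶜ = Uᶜ \ {b} by ext; simp [not_or, and_comm],
        Set.ncard_sdiff_singleton_of_mem hb, hm]
      rfl

end Basic

/-! ### Colorings of small subgraphs, checked by `decide` -/

section Certificate

/-- The edges between consecutive entries of a list of vertices. -/
def pairs {α : Type*} : List α → List (Sym2 α)
  | a :: b :: l => s(a, b) :: pairs (b :: l)
  | _ => []

lemma pairs_map {α β : Type*} (f : α → β) (l : List α) :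
    pairs (l.map f) = (pairs l).map (Sym2.map f) := by
  induction l with
  | nil => rfl
  | cons a l ih =>
    cases l with
    | nil => rfl
    | cons b l => simpa [pairs] using ih

lemma exists_path_of_list {V : Type*} {G : SimpleGraph V} (l : List V) {u v : V}
    (hu : l.head? = some u) (hv : l.getLast? = some v) (hnd : l.Nodup)
    (hl : ∀ e ∈ pairs l, e ∈ G.edgeSet) :
    ∃ p : G.Walk u v, p.IsPath ∧ p.support = l ∧ p.edges = pairs l := by
  induction l generalizing u with
  | nil => simp at hu
  | cons a l ih =>
    obtain rfl : a = u := by simpa using hu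
    cases l with
    | nil =>
      obtain rfl : a = v := by simpa using hv
      exact ⟨.nil, by simp, rfl, rfl⟩
    | cons b l =>
      obtain ⟨p, hp, hs, he⟩ := ih (u := b) rfl (by simpa using hv) hnd.of_cons
        (fun e he => hl e (by simp [pairs, he]))
      have hab : G.Adj a b := hl s(a, b) (by simp [pairs])
      have ha : a ∉ b :: l := (List.nodup_cons.mp hnd).1
      exact ⟨.cons hab p, hp.cons (hs ▸ ha), by simp [hs], by simp [he, pairs]⟩

/-- A family `L` of paths, with edges in `E`, that certifies that `c` makes the graph on `Fin m`
with edge list `E` conflict-free connected. -/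
def IsCertificate {m : ℕ} (E : List (Sym2 (Fin m))) (c : Sym2 (Fin m) → ℕ)
    (L : List (List (Fin m))) : Prop :=
  ∀ i j : Fin m, i < j → ∃ l ∈ L, l.head? = some i ∧ l.getLast? = some j ∧ l.Nodup ∧
    pairs l ⊆ E ∧ HasUniqueValue c (pairs l)

instance {m : ℕ} (E : List (Sym2 (Fin m))) (c : Sym2 (Fin m) → ℕ) (L : List (List (Fin m))) :
    Decidable (IsCertificate E c L) :=
  inferInstanceAs (Decidable (∀ i j : Fin m, i < j → ∃ l ∈ L, l.head? = some i ∧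
    l.getLast? = some j ∧ l.Nodup ∧ pairs l ⊆ E ∧ HasUniqueValue c (pairs l)))

/-- The small graph need only be a subgraph, not an induced one: further edges do not affect the
listed paths. Each vertex outside it costs one color. -/
lemma IsCertificate.cfColorable {V : Type*} [Fintype V] {G : SimpleGraph V} (hG : G.Connected)
    {m k : ℕ} [NeZero m] {E : List (Sym2 (Fin m))} {c : Sym2 (Fin m) → ℕ} {L : List (List (Fin m))}
    (h : IsCertificate E c L) (hc : ∀ e, c e < k) (f : Fin m → V) (hf : f.Injective)
    (hE : ∀ e ∈ E, e.map f ∈ G.edgeSet) : G.CFColorable (k + (Fintype.card V - m)) := by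
  have hfm := Sym2.map.injective hf
  -- The default value off the image of `f` is itself a value of `c`, so the bound `k` persists.
  set c' : Sym2 V → ℕ := Function.extend (Sym2.map f) c (fun _ => c s(0, 0)) with hc'
  have hcard : (Set.range f)ᶜ.ncard = Fintype.card V - m := by
    rw [Set.ncard_compl, Nat.card_eq_fintype_card, ← Set.image_univ,
      Set.ncard_image_of_injective _ hf, Set.ncard_univ, Nat.card_eq_fintype_card, Fintype.card_fin]
  rw [← hcard]
  have key : ∀ i j : Fin m, i < j → G.LinkedIn c' (Set.range f) (f i) (f j) := by
    intro i j hij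
    obtain ⟨l, -, hi, hj, hnd, hl, e, he, h'⟩ := h i j hij
    obtain ⟨p, hp, hs, hpe⟩ := exists_path_of_list (G := G) (l.map f) (u := f i) (v := f j)
      (by simp [hi]) (by simp [hj]) (hnd.map hf) (by
        rw [pairs_map]
        simpa using fun e he => hE e (hl he))
    refine ⟨p, hp, ?_, e.map f, ?_, ?_⟩
    · simp [hs]
    · rw [hpe, pairs_map]; exact List.mem_map_of_mem he
    · intro e' he' hce
      rw [hpe, pairs_map] at he'
      obtain ⟨d, hd, rfl⟩ := List.mem_map.mp he'
      rw [hc', hfm.extend_apply, hfm.extend_apply] at hce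
      rw [h' d hd hce]
  refine .of_subset (c := c') (U := Set.range f) hG (fun e => ?_) ⟨f 0, 0, rfl⟩ ?_
  · by_cases he : ∃ e', Sym2.map f e' = e
    · obtain ⟨e', rfl⟩ := he
      rw [hc', hfm.extend_apply]; exact hc e'
    · rw [hc', Function.extend_apply' _ _ _ he]; exact hc _
  · rintro _ ⟨i, rfl⟩ _ ⟨j, rfl⟩ hij
    rcases lt_trichotomy i j with h | h | h
    · exact key i j h
    · exact absurd (congrArg f h) hij
    · exact (key j i h).symm

end Certificate

end SimpleGraph

namespace SimpleGraph

/-! ### The catalogue of small subgraphs -/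

section SmallSubgraphs

variable {V : Type*} [Fintype V] {G : SimpleGraph V} {v₀ v₁ v₂ v₃ v₄ v₅ : V}

lemma cfColorable_of_path_four (hG : G.Connected) (hnd : [v₀, v₁, v₂, v₃].Nodup)
    (h₀₁ : G.Adj v₀ v₁) (h₁₂ : G.Adj v₁ v₂) (h₂₃ : G.Adj v₂ v₃) :
    G.CFColorable (2 + (Fintype.card V - 4)) :=
  IsCertificate.cfColorable hG (m := 4) (E := [s(0, 1), s(1, 2), s(2, 3)])
    (c := fun e => if e = s(1, 2) then 1 else 0)
    (L := [[0, 1], [0, 1, 2], [0, 1, 2, 3], [1, 2], [1, 2, 3], [2, 3]])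
    (by decide) (fun e => by split_ifs <;> norm_num) ![v₀, v₁, v₂, v₃]
    (List.nodup_ofFn.mp (by simpa using hnd)) (by simp [h₀₁, h₁₂, h₂₃])

/-- One distinguished edge suffices: any two vertices are adjacent or joined by a path through it.
On five vertices, two colors give `n - 3` in total. -/
lemma cfColorable_of_cycle_five (hG : G.Connected) (hnd : [v₀, v₁, v₂, v₃, v₄].Nodup)
    (h₀₁ : G.Adj v₀ v₁) (h₁₂ : G.Adj v₁ v₂) (h₂₃ : G.Adj v₂ v₃) (h₃₄ : G.Adj v₃ v₄)
    (h₀₄ : G.Adj v₀ v₄) : G.CFColorable (2 + (Fintype.card V - 5)) :=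
  IsCertificate.cfColorable hG (m := 5) (E := [s(0, 1), s(1, 2), s(2, 3), s(3, 4), s(0, 4)])
    (c := fun e => if e = s(0, 1) then 1 else 0)
    (L := [[0, 1], [0, 1, 2], [0, 1, 2, 3], [0, 4], [1, 2], [1, 0, 4, 3], [1, 0, 4], [2, 3],
      [2, 1, 0, 4], [3, 4]])
    (by decide) (fun e => by split_ifs <;> norm_num) ![v₀, v₁, v₂, v₃, v₄]
    (List.nodup_ofFn.mp (by simpa using hnd)) (by simp [h₀₁, h₁₂, h₂₃, h₃₄, h₀₄])

/-- The subgraph is a four-cycle with a pendant edge. -/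
lemma cfColorable_of_banner (hG : G.Connected) (hnd : [v₀, v₁, v₂, v₃, v₄].Nodup)
    (h₀₁ : G.Adj v₀ v₁) (h₁₂ : G.Adj v₁ v₂) (h₂₃ : G.Adj v₂ v₃) (h₀₃ : G.Adj v₀ v₃)
    (h₀₄ : G.Adj v₀ v₄) : G.CFColorable (2 + (Fintype.card V - 5)) :=
  IsCertificate.cfColorable hG (m := 5) (E := [s(0, 1), s(1, 2), s(2, 3), s(0, 3), s(0, 4)])
    (c := fun e => if e = s(0, 1) then 1 else 0)
    (L := [[0, 1], [0, 1, 2], [0, 3], [0, 4], [1, 2], [1, 0, 3], [1, 0, 4], [2, 3],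
      [2, 1, 0, 4], [3, 2, 1, 0, 4]])
    (by decide) (fun e => by split_ifs <;> norm_num) ![v₀, v₁, v₂, v₃, v₄]
    (List.nodup_ofFn.mp (by simpa using hnd)) (by simp [h₀₁, h₁₂, h₂₃, h₀₃, h₀₄])

/-- The subgraph is a triangle with pendant edges at two of its vertices. -/
lemma cfColorable_of_bull (hG : G.Connected) (hnd : [v₀, v₁, v₂, v₃, v₄].Nodup)
    (h₀₁ : G.Adj v₀ v₁) (h₁₂ : G.Adj v₁ v₂) (h₀₂ : G.Adj v₀ v₂) (h₀₃ : G.Adj v₀ v₃)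
    (h₁₄ : G.Adj v₁ v₄) : G.CFColorable (2 + (Fintype.card V - 5)) :=
  IsCertificate.cfColorable hG (m := 5) (E := [s(0, 1), s(1, 2), s(0, 2), s(0, 3), s(1, 4)])
    (c := fun e => if e = s(0, 1) then 1 else 0)
    (L := [[0, 1], [0, 2], [0, 3], [0, 1, 4], [1, 2], [1, 0, 3], [1, 4], [2, 1, 0, 3],
      [2, 0, 1, 4], [3, 0, 1, 4]])
    (by decide) (fun e => by split_ifs <;> norm_num) ![v₀, v₁, v₂, v₃, v₄]
    (List.nodup_ofFn.mp (by simpa using hnd)) (by simp [h₀₁, h₁₂, h₀₂, h₀₃, h₁₄])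

/-- The subgraph is a triangle with a path of length two attached to one of its vertices. -/
lemma cfColorable_of_lollipop (hG : G.Connected) (hnd : [v₀, v₁, v₂, v₃, v₄].Nodup)
    (h₀₁ : G.Adj v₀ v₁) (h₁₂ : G.Adj v₁ v₂) (h₀₂ : G.Adj v₀ v₂) (h₀₃ : G.Adj v₀ v₃)
    (h₃₄ : G.Adj v₃ v₄) : G.CFColorable (2 + (Fintype.card V - 5)) :=
  IsCertificate.cfColorable hG (m := 5) (E := [s(0, 1), s(1, 2), s(0, 2), s(0, 3), s(3, 4)])
    (c := fun e => if e = s(1, 2) ∨ e = s(3, 4) then 1 else 0)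
    (L := [[0, 1], [0, 2], [0, 3], [0, 3, 4], [1, 2], [1, 2, 0, 3], [1, 0, 3, 4], [2, 1, 0, 3],
      [2, 0, 3, 4], [3, 4]])
    (by decide) (fun e => by split_ifs <;> norm_num) ![v₀, v₁, v₂, v₃, v₄]
    (List.nodup_ofFn.mp (by simpa using hnd)) (by simp [h₀₁, h₁₂, h₀₂, h₀₃, h₃₄])

/-- The color pattern is `0, 1, 0, 2, 0`. On six vertices, three colors again give `n - 3` in total.
-/
lemma cfColorable_of_path_six (hG : G.Connected) (hnd : [v₀, v₁, v₂, v₃, v₄, v₅].Nodup)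
    (h₀₁ : G.Adj v₀ v₁) (h₁₂ : G.Adj v₁ v₂) (h₂₃ : G.Adj v₂ v₃) (h₃₄ : G.Adj v₃ v₄)
    (h₄₅ : G.Adj v₄ v₅) : G.CFColorable (3 + (Fintype.card V - 6)) :=
  IsCertificate.cfColorable hG (m := 6) (E := [s(0, 1), s(1, 2), s(2, 3), s(3, 4), s(4, 5)])
    (c := fun e => if e = s(1, 2) then 1 else if e = s(3, 4) then 2 else 0)
    (L := [[0, 1], [0, 1, 2], [0, 1, 2, 3], [0, 1, 2, 3, 4], [0, 1, 2, 3, 4, 5], [1, 2],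
      [1, 2, 3], [1, 2, 3, 4], [1, 2, 3, 4, 5], [2, 3], [2, 3, 4], [2, 3, 4, 5], [3, 4],
      [3, 4, 5], [4, 5]])
    (by decide) (fun e => by split_ifs <;> norm_num) ![v₀, v₁, v₂, v₃, v₄, v₅]
    (List.nodup_ofFn.mp (by simpa using hnd)) (by simp [h₀₁, h₁₂, h₂₃, h₃₄, h₄₅])

/-- The subgraph is a path on five vertices with a pendant edge at its second vertex. -/
lemma cfColorable_of_path_five_adj_second (hG : G.Connected)
    (hnd : [v₀, v₁, v₂, v₃, v₄, v₅].Nodup)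
    (h₀₁ : G.Adj v₀ v₁) (h₁₂ : G.Adj v₁ v₂) (h₂₃ : G.Adj v₂ v₃) (h₃₄ : G.Adj v₃ v₄)
    (h₁₅ : G.Adj v₁ v₅) : G.CFColorable (3 + (Fintype.card V - 6)) :=
  IsCertificate.cfColorable hG (m := 6) (E := [s(0, 1), s(1, 2), s(2, 3), s(3, 4), s(1, 5)])
    (c := fun e => if e = s(1, 2) then 1 else if e = s(3, 4) ∨ e = s(1, 5) then 2 else 0)
    (L := [[0, 1], [0, 1, 2], [0, 1, 2, 3], [0, 1, 2, 3, 4], [0, 1, 5], [1, 2],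
      [1, 2, 3], [1, 2, 3, 4], [1, 5], [2, 3], [2, 3, 4], [2, 1, 5], [3, 4],
      [3, 2, 1, 5], [4, 3, 2, 1, 5]])
    (by decide) (fun e => by split_ifs <;> norm_num) ![v₀, v₁, v₂, v₃, v₄, v₅]
    (List.nodup_ofFn.mp (by simpa using hnd)) (by simp [h₀₁, h₁₂, h₂₃, h₃₄, h₁₅])

/-- The subgraph is a path on five vertices with a pendant edge at its middle vertex. -/
lemma cfColorable_of_path_five_adj_third (hG : G.Connected)
    (hnd : [v₀, v₁, v₂, v₃, v₄, v₅].Nodup)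
    (h₀₁ : G.Adj v₀ v₁) (h₁₂ : G.Adj v₁ v₂) (h₂₃ : G.Adj v₂ v₃) (h₃₄ : G.Adj v₃ v₄)
    (h₂₅ : G.Adj v₂ v₅) : G.CFColorable (3 + (Fintype.card V - 6)) :=
  IsCertificate.cfColorable hG (m := 6) (E := [s(0, 1), s(1, 2), s(2, 3), s(3, 4), s(2, 5)])
    (c := fun e => if e = s(1, 2) then 1 else if e = s(2, 3) then 2 else 0)
    (L := [[0, 1], [0, 1, 2], [0, 1, 2, 3], [0, 1, 2, 3, 4], [0, 1, 2, 5], [1, 2],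
      [1, 2, 3], [1, 2, 3, 4], [1, 2, 5], [2, 3], [2, 3, 4], [2, 5], [3, 4],
      [3, 2, 5], [4, 3, 2, 5]])
    (by decide) (fun e => by split_ifs <;> norm_num) ![v₀, v₁, v₂, v₃, v₄, v₅]
    (List.nodup_ofFn.mp (by simpa using hnd)) (by simp [h₀₁, h₁₂, h₂₃, h₃₄, h₂₅])

lemma cfColorable_of_double_star (hG : G.Connected) (hnd : [v₀, v₁, v₂, v₃, v₄, v₅].Nodup)
    (h₀₁ : G.Adj v₀ v₁) (h₀₂ : G.Adj v₀ v₂) (h₀₃ : G.Adj v₀ v₃) (h₁₄ : G.Adj v₁ v₄)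
    (h₁₅ : G.Adj v₁ v₅) : G.CFColorable (3 + (Fintype.card V - 6)) :=
  IsCertificate.cfColorable hG (m := 6) (E := [s(0, 1), s(0, 2), s(0, 3), s(1, 4), s(1, 5)])
    (c := fun e => if e = s(0, 1) then 1 else if e = s(0, 2) ∨ e = s(1, 4) then 2 else 0)
    (L := [[0, 1], [0, 2], [0, 3], [0, 1, 4], [0, 1, 5], [1, 0, 2], [1, 0, 3], [1, 4], [1, 5],
      [2, 0, 3], [2, 0, 1, 4], [2, 0, 1, 5], [3, 0, 1, 4], [3, 0, 1, 5], [4, 1, 5]])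
    (by decide) (fun e => by split_ifs <;> norm_num) ![v₀, v₁, v₂, v₃, v₄, v₅]
    (List.nodup_ofFn.mp (by simpa using hnd)) (by simp [h₀₁, h₀₂, h₀₃, h₁₄, h₁₅])

end SmallSubgraphs

end SimpleGraph

namespace SimpleGraph

/-! ### Graphs that need more than `n - 3` colors -/

section Structure

variable {V : Type*} {G : SimpleGraph V}

lemma Connected.exists_adj_boundary (hG : G.Connected) (U : Set V) {u v : V} (hu : u ∈ U)
    (hv : v ∉ U) : ∃ a ∈ U, ∃ b ∉ U, G.Adj a b := by
  obtain ⟨⟨⟨a, b⟩, hab⟩, -, ha, hb⟩ := (hG u v).some.exists_boundary_dart U hu hv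
  exact ⟨a, ha, b, hb, hab⟩

lemma exists_not_adj_of_compl_connected [Nontrivial V] (hG : Gᶜ.Connected) (v : V) :
    ∃ w, w ≠ v ∧ ¬ G.Adj v w := by
  obtain ⟨w, hw⟩ := exists_ne v
  obtain ⟨a, rfl, b, -, hab⟩ := hG.exists_adj_boundary {v} (u := v) (v := w) rfl (by simpa using hw)
  exact ⟨b, hab.ne', ((compl_adj _ _ _).mp hab).2⟩

variable [Fintype V]

lemma exists_notMem_of_length_lt (l : List V) (h : l.length < Fintype.card V) : ∃ v, v ∉ l := by
  classical
  by_contra! hl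
  have : Fintype.card V ≤ l.toFinset.card := by
    rw [← Finset.card_univ]
    exact Finset.card_le_card fun v _ => by simpa using hl v
  exact absurd (this.trans l.toFinset_card_le) (by omega)

lemma card_ge_of_nodup {l : List V} (h : l.Nodup) : l.length ≤ Fintype.card V := by
  classical
  rw [← List.toFinset_card_of_nodup h]
  exact Finset.card_le_univ _

/-- Take a vertex `c` with two neighbors. It is not dominating, so some edge `ab` leaves its closed
neighborhood at a neighbor `a`; a second neighbor `z` of `c` gives the path `z, c, a, b`. -/
lemma exists_path_four (hG : G.Connected) (hd : ∀ v, ∃ w, w ≠ v ∧ ¬ G.Adj v w)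
    (hn : 3 ≤ Fintype.card V) : ∃ v₀ v₁ v₂ v₃, [v₀, v₁, v₂, v₃].Nodup ∧
      G.Adj v₀ v₁ ∧ G.Adj v₁ v₂ ∧ G.Adj v₂ v₃ := by
  obtain ⟨c, x, y, hxy, hx, hy⟩ : ∃ c x y, x ≠ y ∧ G.Adj c x ∧ G.Adj c y := by
    obtain ⟨v⟩ := hG.nonempty
    obtain ⟨t, ht⟩ := exists_notMem_of_length_lt [v] (by simp; omega)
    obtain ⟨v, rfl, w, hw, hvw⟩ := hG.exists_adj_boundary {v} (u := v) (v := t) rfl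
      (by simpa using ht)
    obtain ⟨t, ht⟩ := exists_notMem_of_length_lt [v, w] (by simp; omega)
    obtain ⟨a, ha, b, hb, hab⟩ := hG.exists_adj_boundary {v, w} (u := v) (v := t) (by simp)
      (by simpa using ht)
    simp only [Set.mem_insert_iff, Set.mem_singleton_iff, not_or] at ha hb
    rcases ha with rfl | rfl
    · exact ⟨a, w, b, fun h => hb.2 h.symm, hvw, hab⟩
    · exact ⟨a, v, b, fun h => hb.1 h.symm, hvw.symm, hab⟩
  obtain ⟨w, hw, hcw⟩ := hd c
  obtain ⟨a, ha, b, hb, hab⟩ := hG.exists_adj_boundary {v | v = c ∨ G.Adj c v} (u := c) (v := w)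
    (by simp) (by simp [hw, hcw])
  simp only [Set.mem_ofPred_eq, not_or] at ha hb
  have hca : G.Adj c a := ha.resolve_left (by rintro rfl; exact hb.2 hab)
  obtain ⟨z, hz, hza⟩ : ∃ z, G.Adj c z ∧ z ≠ a := by
    by_cases h : x = a
    · exact ⟨y, hy, by rw [← h]; exact hxy.symm⟩
    · exact ⟨x, hx, h⟩
  refine ⟨z, c, a, b, ?_, hz.symm, hca, hab⟩
  have := hz.ne; have := hca.ne; have := hab.ne
  have : z ≠ b := by rintro rfl; exact hb.2 hz
  simp
  grind

/-- There are at most `n - 2` edges at `c` and one elsewhere, so connectedness forces a tree. No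
degree exceeds `n - 2`, since no vertex is dominating. -/
lemma isTree_and_maxDegree_of_near_star [DecidableRel G.Adj] (hG : G.Connected)
    (hd : ∀ v, ∃ w, w ≠ v ∧ ¬ G.Adj v w) {a b c : V} (hcb : c ≠ b) (hnadj : ¬ G.Adj c b)
    (hc : ∀ x, x ≠ c → x ≠ b → G.Adj c x)
    (hE : ∀ u w, G.Adj u w → u ≠ c → w ≠ c → s(u, w) = s(a, b)) :
    G.IsTree ∧ G.maxDegree = Fintype.card V - 2 := by
  classical
  have hdeg : ∀ v, G.degree v ≤ Fintype.card V - 2 := fun v => by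
    obtain ⟨w, hwv, hvw⟩ := hd v
    have : G.neighborFinset v ⊆ (Finset.univ.erase v).erase w := fun x hx => by
      rw [mem_neighborFinset] at hx
      simp only [Finset.mem_erase, Finset.mem_univ, and_true]
      exact ⟨by rintro rfl; exact hvw hx, hx.ne'⟩
    have h := Finset.card_le_card this
    rw [Finset.card_erase_of_mem (by simp [hwv]), Finset.card_erase_of_mem (by simp)] at h
    simpa [Nat.sub_sub] using h
  have hN : G.neighborFinset c = (Finset.univ.erase c).erase b := by
    ext x
    simp only [mem_neighborFinset, Finset.mem_erase, Finset.mem_univ, and_true]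
    exact ⟨fun h => ⟨by rintro rfl; exact hnadj h, h.ne'⟩, fun h => hc x h.2 h.1⟩
  have hNcard : ((Finset.univ.erase c).erase b).card = Fintype.card V - 2 := by
    rw [Finset.card_erase_of_mem (by simp [hcb.symm]), Finset.card_erase_of_mem (by simp)]
    simp [Nat.sub_sub]
  have h2 : 2 ≤ Fintype.card V := card_ge_of_nodup (l := [c, b]) (by simpa using hcb)
  refine ⟨isTree_iff_connected_and_card.mpr ⟨hG, ?_⟩, le_antisymm ?_ ?_⟩
  · refine le_antisymm ?_ hG.card_vert_le_card_edgeSet_add_one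
    have hsub : G.edgeSet ⊆
        ↑(insert s(a, b) (((Finset.univ.erase c).erase b).image fun x => s(c, x))) := by
      intro e he
      induction e with
      | _ u w =>
        simp only [Finset.coe_insert, Finset.coe_image, Set.mem_insert_iff, Set.mem_image,
          Finset.mem_coe, Finset.mem_erase, Finset.mem_univ, and_true]
        rw [mem_edgeSet] at he
        by_cases hu : u = c
        · subst hu
          exact .inr ⟨w, ⟨by rintro rfl; exact hnadj he, he.ne'⟩, rfl⟩
        · by_cases hw : w = c
          · subst hw
            exact .inr ⟨u, ⟨by rintro rfl; exact hnadj he.symm, hu⟩, Sym2.eq_swap⟩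
          · exact .inl (hE u w he hu hw)
    have h := Set.ncard_le_ncard hsub (Finset.finite_toSet _)
    rw [Set.ncard_coe_finset] at h
    have h' := (h.trans (Finset.card_insert_le _ _)).trans
      (Nat.add_le_add_right Finset.card_image_le 1)
    rw [Nat.card_coe_set_eq, Nat.card_eq_fintype_card]
    omega
  · exact G.maxDegree_le_of_forall_degree_le _ hdeg
  · rw [← hNcard, ← hN]
    exact G.degree_le_maxDegree c

variable {v₀ v₁ v₂ v₃ v₄ : V}

/-- On five vertices, any chord of the path creates a two-colorable subgraph of the catalogue. On
more vertices, some sixth vertex is attached to the path, and each attachment is in the catalogue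
with three colors. -/
lemma cfColorable_of_path_five (hG : G.Connected) (hiso : ¬ Nonempty (G ≃g pathGraph 5))
    (hnd : [v₀, v₁, v₂, v₃, v₄].Nodup) (h₀₁ : G.Adj v₀ v₁) (h₁₂ : G.Adj v₁ v₂)
    (h₂₃ : G.Adj v₂ v₃) (h₃₄ : G.Adj v₃ v₄) : G.CFColorable (Fintype.card V - 3) := by
  have hcard := card_ge_of_nodup hnd
  simp only [List.length_cons, List.length_nil, zero_add, Nat.reduceAdd] at hcard
  by_contra hcol
  rcases hcard.eq_or_lt with h5 | h6
  · rw [show Fintype.card V - 3 = 2 + (Fintype.card V - 5) by omega] at hcol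
    have n₀₂ : ¬ G.Adj v₀ v₂ := fun h => hcol <|
      cfColorable_of_lollipop hG (v₀ := v₂) (v₁ := v₀) (v₂ := v₁) (v₃ := v₃) (v₄ := v₄)
        (by simp at hnd ⊢; grind) h.symm h₀₁ h₁₂.symm h₂₃ h₃₄
    have n₁₃ : ¬ G.Adj v₁ v₃ := fun h => hcol <|
      cfColorable_of_bull hG (v₀ := v₁) (v₁ := v₃) (v₂ := v₂) (v₃ := v₀) (v₄ := v₄)
        (by simp at hnd ⊢; grind) h h₂₃.symm h₁₂ h₀₁.symm h₃₄
    have n₂₄ : ¬ G.Adj v₂ v₄ := fun h => hcol <|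
      cfColorable_of_lollipop hG (v₀ := v₂) (v₁ := v₃) (v₂ := v₄) (v₃ := v₁) (v₄ := v₀)
        (by simp at hnd ⊢; grind) h₂₃ h₃₄ h h₁₂.symm h₀₁.symm
    have n₀₃ : ¬ G.Adj v₀ v₃ := fun h => hcol <|
      cfColorable_of_banner hG (v₀ := v₃) (v₁ := v₀) (v₂ := v₁) (v₃ := v₂) (v₄ := v₄)
        (by simp at hnd ⊢; grind) h.symm h₀₁ h₁₂ h₂₃.symm h₃₄
    have n₁₄ : ¬ G.Adj v₁ v₄ := fun h => hcol <|
      cfColorable_of_banner hG (v₀ := v₁) (v₁ := v₂) (v₂ := v₃) (v₃ := v₄) (v₄ := v₀)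
        (by simp at hnd ⊢; grind) h₁₂ h₂₃ h₃₄ h h₀₁.symm
    have n₀₄ : ¬ G.Adj v₀ v₄ := fun h => hcol <|
      cfColorable_of_cycle_five hG hnd h₀₁ h₁₂ h₂₃ h₃₄ h
    have hinj : Function.Injective ![v₀, v₁, v₂, v₃, v₄] :=
      List.nodup_ofFn.mp (by simpa using hnd)
    have hbij : Function.Bijective ![v₀, v₁, v₂, v₃, v₄] := by
      rw [Fintype.bijective_iff_injective_and_card]
      exact ⟨hinj, by simp [← h5]⟩
    refine hiso ⟨RelIso.symm ⟨Equiv.ofBijective _ hbij, ?_⟩⟩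
    intro i j
    rw [pathGraph_adj]
    fin_cases i <;> fin_cases j <;>
      simp [h₀₁, h₁₂, h₂₃, h₃₄, n₀₂, n₁₃, n₂₄, n₀₃, n₁₄, n₀₄, h₀₁.symm, h₁₂.symm, h₂₃.symm,
        h₃₄.symm, mt Adj.symm n₀₂, mt Adj.symm n₁₃, mt Adj.symm n₂₄, mt Adj.symm n₀₃, mt Adj.symm n₁₄,
        mt Adj.symm n₀₄]
  · rw [show Fintype.card V - 3 = 3 + (Fintype.card V - 6) by omega] at hcol
    obtain ⟨t, ht⟩ := exists_notMem_of_length_lt [v₀, v₁, v₂, v₃, v₄] (by simpa using h6)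
    obtain ⟨a, ha, b, hb, hab⟩ := hG.exists_adj_boundary {v | v ∈ [v₀, v₁, v₂, v₃, v₄]}
      (u := v₀) (v := t) (by simp) ht
    have hnd' : [v₀, v₁, v₂, v₃, v₄, b].Nodup := by
      simp at hnd hb ⊢; grind
    refine hcol ?_
    simp only [List.mem_cons, List.not_mem_nil, or_false, Set.mem_ofPred_eq] at ha
    rcases ha with rfl | rfl | rfl | rfl | rfl
    · exact cfColorable_of_path_six hG (v₀ := b) (by simp at hnd' ⊢; grind) hab.symm
        h₀₁ h₁₂ h₂₃ h₃₄
    · exact cfColorable_of_path_five_adj_second hG hnd' h₀₁ h₁₂ h₂₃ h₃₄ hab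
    · exact cfColorable_of_path_five_adj_third hG hnd' h₀₁ h₁₂ h₂₃ h₃₄ hab
    · exact cfColorable_of_path_five_adj_second hG (v₀ := v₄) (v₁ := a) (v₂ := v₂) (v₃ := v₁)
        (v₄ := v₀) (v₅ := b) (by simp at hnd' ⊢; grind) h₃₄.symm h₂₃.symm h₁₂.symm h₀₁.symm hab
    · exact cfColorable_of_path_six hG hnd' h₀₁ h₁₂ h₂₃ h₃₄ hab

lemma cfColorable_of_not_isNearStarOrP5 [DecidableRel G.Adj] (hG : G.Connected)
    (hd : ∀ v, ∃ w, w ≠ v ∧ ¬ G.Adj v w) (hn : 5 ≤ Fintype.card V) (h : ¬ G.IsNearStarOrP5) :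
    G.CFColorable (Fintype.card V - 3) := by
  by_contra hcol
  rw [IsNearStarOrP5, not_or] at h
  refine h.1 ?_
  have noP5 : ∀ v₀ v₁ v₂ v₃ v₄, [v₀, v₁, v₂, v₃, v₄].Nodup → G.Adj v₀ v₁ → G.Adj v₁ v₂ →
      G.Adj v₂ v₃ → G.Adj v₃ v₄ → False := fun v₀ v₁ v₂ v₃ v₄ hnd h₀₁ h₁₂ h₂₃ h₃₄ =>
    hcol (cfColorable_of_path_five hG h.2 hnd h₀₁ h₁₂ h₂₃ h₃₄)
  have h5 : Fintype.card V - 3 = 2 + (Fintype.card V - 5) := by omega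
  -- A fifth vertex attached at an end would give a path on five vertices; up to reversal it is
  -- attached at `p₁`.
  obtain ⟨p₀, p₁, p₂, p₃, hnd, h₀₁, h₁₂, h₂₃, x, hx, hx₁⟩ : ∃ p₀ p₁ p₂ p₃, [p₀, p₁, p₂, p₃].Nodup ∧
      G.Adj p₀ p₁ ∧ G.Adj p₁ p₂ ∧ G.Adj p₂ p₃ ∧ ∃ x ∉ [p₀, p₁, p₂, p₃], G.Adj p₁ x := by
    obtain ⟨p₀, p₁, p₂, p₃, hnd, h₀₁, h₁₂, h₂₃⟩ := exists_path_four hG hd (by omega)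
    obtain ⟨t, ht⟩ := exists_notMem_of_length_lt [p₀, p₁, p₂, p₃] (by simp; omega)
    obtain ⟨a, ha, b, hb, hab⟩ := hG.exists_adj_boundary {v | v ∈ [p₀, p₁, p₂, p₃]}
      (u := p₀) (v := t) (by simp) ht
    simp only [List.mem_cons, List.not_mem_nil, or_false, Set.mem_ofPred_eq] at ha
    rcases ha with rfl | rfl | rfl | rfl
    · exact (noP5 b a p₁ p₂ p₃ (by simp at hnd hb ⊢; grind) hab.symm h₀₁ h₁₂ h₂₃).elim
    · exact ⟨p₀, a, p₂, p₃, hnd, h₀₁, h₁₂, h₂₃, b, hb, hab⟩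
    · exact ⟨p₃, a, p₁, p₀, by simp at hnd ⊢; grind, h₂₃.symm, h₁₂.symm, h₀₁.symm, b,
        by simp at hb ⊢; grind, hab⟩
    · exact (noP5 p₀ p₁ p₂ a b (by simp at hnd hb ⊢; grind) h₀₁ h₁₂ h₂₃ hab).elim
  -- Outside neighbors of both `p₁` and `p₂` form a bull if equal and a double star otherwise.
  have hy₂ : ∀ y ∉ [p₀, p₁, p₂, p₃], ¬ G.Adj p₂ y := by
    intro y hy h₂y
    by_cases hxy : x = y
    · subst hxy
      refine hcol (h5 ▸ cfColorable_of_bull hG (v₀ := p₁) (v₁ := p₂) (v₂ := x) (v₃ := p₀)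
        (v₄ := p₃) (by simp at hnd hx ⊢; grind) h₁₂ h₂y hx₁ h₀₁.symm h₂₃)
    · have h6 : [p₁, p₂, p₀, x, p₃, y].Nodup := by simp at hnd hx hy ⊢; grind
      have hcard := card_ge_of_nodup h6
      refine hcol ?_
      rw [show Fintype.card V - 3 = 3 + (Fintype.card V - 6) by simp at hcard; omega]
      exact cfColorable_of_double_star hG h6 h₁₂ h₀₁.symm hx₁ h₂₃ h₂y
  -- Otherwise an edge leaves the union of the path and the neighborhood of `p₁`, which yields a
  -- path on five vertices or contradicts `hy₂`.
  have hy₁ : ∀ y ∉ [p₀, p₁, p₂, p₃], G.Adj p₁ y := by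
    by_contra! hy
    obtain ⟨y, hy, h₁y⟩ := hy
    obtain ⟨a, ha, b, hb, hab⟩ := hG.exists_adj_boundary
      {v | v ∈ [p₀, p₁, p₂, p₃] ∨ G.Adj p₁ v} (u := p₀) (v := y) (by simp)
      (by simp [*] at hy ⊢; grind)
    simp only [List.mem_cons, List.not_mem_nil, or_false, Set.mem_ofPred_eq, not_or] at ha hb
    by_cases hap : a ∈ [p₀, p₁, p₂, p₃]
    · simp only [List.mem_cons, List.not_mem_nil, or_false] at hap
      rcases hap with rfl | rfl | rfl | rfl
      · exact noP5 b a p₁ p₂ p₃ (by simp at hnd ⊢; grind) hab.symm h₀₁ h₁₂ h₂₃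
      · exact hb.2 hab
      · exact hy₂ b (by simp; grind) hab
      · exact noP5 p₀ p₁ p₂ a b (by simp at hnd ⊢; grind) h₀₁ h₁₂ h₂₃ hab
    · have h₁a : G.Adj p₁ a := by simp at hap; grind
      exact noP5 b a p₁ p₂ p₃ (by have := hab.ne; simp at hnd hap ⊢; grind) hab.symm
        h₁a.symm h₁₂ h₂₃
  have h₁₃ : ¬ G.Adj p₁ p₃ := by
    intro h₁₃
    obtain ⟨w, hw, hw'⟩ := hd p₁
    by_cases hwp : w ∈ [p₀, p₁, p₂, p₃]
    · simp only [List.mem_cons, List.not_mem_nil, or_false] at hwp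
      rcases hwp with rfl | rfl | rfl | rfl
      · exact hw' h₀₁.symm
      · exact hw rfl
      · exact hw' h₁₂
      · exact hw' h₁₃
    · exact hw' (hy₁ w hwp)
  have h₀₂ : ¬ G.Adj p₀ p₂ := fun h₀₂ => hcol <| h5 ▸
    cfColorable_of_bull hG (v₀ := p₁) (v₁ := p₂) (v₂ := p₀) (v₃ := x) (v₄ := p₃)
      (by simp at hnd hx ⊢; grind) h₁₂ h₀₂.symm h₀₁.symm hx₁ h₂₃
  have h₀₃ : ¬ G.Adj p₀ p₃ := fun h₀₃ => hcol <| h5 ▸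
    cfColorable_of_banner hG (v₀ := p₁) (v₁ := p₂) (v₂ := p₃) (v₃ := p₀) (v₄ := x)
      (by simp at hnd hx ⊢; grind) h₁₂ h₂₃ h₀₃.symm h₀₁.symm hx₁
  have hout : ∀ u ∉ [p₀, p₁, p₂, p₃], ∀ w, w ≠ p₁ → ¬ G.Adj u w := by
    intro u hu w hw huw
    by_cases hwp : w ∈ [p₀, p₁, p₂, p₃]
    · simp only [List.mem_cons, List.not_mem_nil, or_false] at hwp
      rcases hwp with rfl | rfl | rfl | rfl
      · exact noP5 u w p₁ p₂ p₃ (by simp at hnd hu ⊢; grind) huw h₀₁ h₁₂ h₂₃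
      · exact hw rfl
      · exact hy₂ u hu huw.symm
      · exact noP5 p₀ p₁ p₂ w u (by simp at hnd hu ⊢; grind) h₀₁ h₁₂ h₂₃ huw.symm
    · exact noP5 u w p₁ p₂ p₃ (by have := huw.ne; simp at hnd hu hwp ⊢; grind) huw
        (hy₁ w hwp).symm h₁₂ h₂₃
  refine isTree_and_maxDegree_of_near_star hG hd (a := p₂) (b := p₃) (c := p₁)
    (by simp at hnd; grind) h₁₃ ?_ ?_
  · intro y hyc hyb
    by_cases hyp : y ∈ [p₀, p₁, p₂, p₃]
    · simp only [List.mem_cons, List.not_mem_nil, or_false] at hyp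
      rcases hyp with rfl | rfl | rfl | rfl
      · exact h₀₁.symm
      · exact absurd rfl hyc
      · exact h₁₂
      · exact absurd rfl hyb
    · exact hy₁ y hyp
  · intro u w huw hu hw
    by_cases hup : u ∈ [p₀, p₁, p₂, p₃]
    · by_cases hwp : w ∈ [p₀, p₁, p₂, p₃]
      · have := huw.symm
        have := huw.ne
        simp only [List.mem_cons, List.not_mem_nil, or_false] at hup hwp
        rw [Sym2.eq_iff]
        grind
      · exact absurd huw.symm (hout w hwp u hu)
    · exact absurd huw (hout u hup w hw)

end Structure

end SimpleGraph

namespace SimpleGraph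

/-! ### Lower bounds and the extremal graphs -/

section LowerBounds

variable {V : Type*} {G : SimpleGraph V}

/-- A path between nonadjacent vertices has at least two edges, so a single color is never unique on
it. -/
lemma CFColorable.two_le {k : ℕ} (h : G.CFColorable k) {u v : V} (huv : u ≠ v)
    (hnadj : ¬ G.Adj u v) : 2 ≤ k := by
  obtain ⟨c, hc⟩ := h
  obtain ⟨p, hp, a, e, ⟨he, hce⟩, huniq⟩ := hc u v huv
  by_contra! hk
  have : Subsingleton (Fin k) := Fin.subsingleton_iff_le_one.mpr (by omega)
  have hall : ∀ e' (he' : e' ∈ p.edges), e' = e := fun e' he' =>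
    congrArg Subtype.val (huniq ⟨e', p.edges_subset_edgeSet he'⟩ ⟨he', Subsingleton.elim _ _⟩)
  have hnd := hp.isTrail.edges_nodup
  cases p with
  | nil => exact huv rfl
  | cons h₁ p =>
    cases p with
    | nil => exact hnadj h₁
    | cons h₂ p =>
      simp only [Walk.edges_cons, List.nodup_cons, List.mem_cons, not_or] at hnd hall
      exact hnd.1.1 ((hall _ (.inl rfl)).trans (hall _ (.inr (.inl rfl))).symm)

lemma IsConflictFreeConnected.isConflictFree_of_isAcyclic {K : Type*} {c : G.edgeSet → K}
    (hc : G.IsConflictFreeConnected c) (hG : G.IsAcyclic) {u v : V} (huv : u ≠ v)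
    {p : G.Walk u v} (hp : p.IsPath) : p.IsConflictFree c := by
  obtain ⟨q, hq, hqc⟩ := hc u v huv
  obtain rfl : p = q := congrArg Subtype.val ((hG.subsingleton_path u v).elim ⟨p, hp⟩ ⟨q, hq⟩)
  exact hqc

/-- The path `x, a, y` is the only one from `x` to `y`. Hence the edges at a vertex of a forest have
distinct colors. -/
lemma IsConflictFreeConnected.color_ne_of_isAcyclic {K : Type*} {c : G.edgeSet → K}
    (hc : G.IsConflictFreeConnected c) (hG : G.IsAcyclic) {a x y : V} (hx : G.Adj a x)
    (hy : G.Adj a y) (hxy : x ≠ y) : c ⟨s(a, x), hx⟩ ≠ c ⟨s(a, y), hy⟩ := by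
  intro heq
  have hp : (Walk.cons hx.symm (.cons hy .nil)).IsPath := by
    simp [hx.ne.symm, hy.ne, hxy]
  obtain ⟨b, ⟨e, he⟩, ⟨hep, hce⟩, huniq⟩ := hc.isConflictFree_of_isAcyclic hG hxy hp
  have hne : s(a, x) ≠ s(a, y) := fun h => hxy (Sym2.congr_right.mp h)
  simp only [Walk.edges_cons, Walk.edges_nil, List.mem_cons, List.not_mem_nil, or_false,
    Sym2.eq_swap (a := x)] at hep huniq
  rcases hep with rfl | rfl
  · exact hne.symm (congrArg Subtype.val (huniq ⟨s(a, y), hy⟩ ⟨.inr rfl, heq ▸ hce⟩))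
  · exact hne (congrArg Subtype.val (huniq ⟨s(a, x), hx⟩ ⟨.inl rfl, heq.trans hce⟩))

lemma CFColorable.degree_le_of_isAcyclic {k : ℕ} (h : G.CFColorable k) (hG : G.IsAcyclic) (a : V)
    [Fintype (G.neighborSet a)] : G.degree a ≤ k := by
  obtain ⟨c, hc⟩ := h
  rw [← card_neighborSet_eq_degree]
  conv_rhs => rw [← Fintype.card_fin k]
  refine Fintype.card_le_of_injective
    (fun x : G.neighborSet a => c ⟨s(a, x), x.2⟩) fun x y hxy => ?_
  by_contra hne
  exact hc.color_ne_of_isAcyclic hG x.2 y.2 (fun h => hne (Subtype.ext h)) hxy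

instance (n : ℕ) : DecidableRel (pathGraph n).Adj := fun _ _ =>
  decidable_of_iff' _ pathGraph_adj

lemma isAcyclic_pathGraph_five : (pathGraph 5).IsAcyclic := by
  have h : (pathGraph 5).IsTree := by
    rw [isTree_iff_connected_and_card]
    refine ⟨pathGraph_connected 4, ?_⟩
    rw [Nat.card_eq_fintype_card, Nat.card_eq_fintype_card]
    decide
  exact h.isAcyclic

/-- With two colors, consecutive edges must alternate, and then each color occurs twice on the whole
path. -/
lemma CFColorable.three_le_of_iso_pathGraph_five {k : ℕ} (h : G.CFColorable k)
    (φ : G ≃g pathGraph 5) : 3 ≤ k := by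
  have hG : G.IsAcyclic := φ.isAcyclic_iff.mpr isAcyclic_pathGraph_five
  obtain ⟨c, hc⟩ := h
  by_contra! hk
  have hadj : ∀ i j : Fin 5, (pathGraph 5).Adj i j → G.Adj (φ.symm i) (φ.symm j) :=
    fun i j hij => φ.symm.map_rel_iff.mpr hij
  have hne : ∀ i j : Fin 5, i ≠ j → φ.symm i ≠ φ.symm j := fun i j => φ.symm.injective.ne
  have h₀₁ := hadj 0 1 (by decide)
  have h₁₂ := hadj 1 2 (by decide)
  have h₂₃ := hadj 2 3 (by decide)
  have h₃₄ := hadj 3 4 (by decide)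
  have n₁ := hc.color_ne_of_isAcyclic hG h₀₁.symm h₁₂ (hne 0 2 (by decide))
  have n₂ := hc.color_ne_of_isAcyclic hG h₁₂.symm h₂₃ (hne 1 3 (by decide))
  have n₃ := hc.color_ne_of_isAcyclic hG h₂₃.symm h₃₄ (hne 2 4 (by decide))
  have hp : (Walk.cons h₀₁ (.cons h₁₂ (.cons h₂₃ (.cons h₃₄ .nil)))).IsPath := by
    simp
  obtain ⟨b, ⟨e, he⟩, ⟨hep, hce⟩, huniq⟩ :=
    hc.isConflictFree_of_isAcyclic hG (hne 0 4 (by decide)) hp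
  simp only [Sym2.eq_swap (a := φ.symm 1) (b := φ.symm 0),
    Sym2.eq_swap (a := φ.symm 2) (b := φ.symm 1),
    Sym2.eq_swap (a := φ.symm 3) (b := φ.symm 2)] at n₁ n₂ n₃
  simp only [Walk.edges_cons, Walk.edges_nil, List.mem_cons, List.not_mem_nil, or_false]
    at hep huniq
  have e₁ : c ⟨s(φ.symm 0, φ.symm 1), h₀₁⟩ = c ⟨s(φ.symm 2, φ.symm 3), h₂₃⟩ := by
    apply Fin.ext
    have := Fin.val_ne_of_ne n₁; have := Fin.val_ne_of_ne n₂
    omega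
  have e₂ : c ⟨s(φ.symm 1, φ.symm 2), h₁₂⟩ = c ⟨s(φ.symm 3, φ.symm 4), h₃₄⟩ := by
    apply Fin.ext
    have := Fin.val_ne_of_ne n₂; have := Fin.val_ne_of_ne n₃
    omega
  have d₁ : s(φ.symm 0, φ.symm 1) ≠ s(φ.symm 2, φ.symm 3) := by simp
  have d₂ : s(φ.symm 1, φ.symm 2) ≠ s(φ.symm 3, φ.symm 4) := by simp
  rcases hep with rfl | rfl | rfl | rfl
  · exact d₁.symm (congrArg Subtype.val (huniq ⟨s(φ.symm 2, φ.symm 3), h₂₃⟩ ⟨by simp, e₁ ▸ hce⟩))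
  · exact d₂.symm (congrArg Subtype.val (huniq ⟨s(φ.symm 3, φ.symm 4), h₃₄⟩ ⟨by simp, e₂ ▸ hce⟩))
  · exact d₁ (congrArg Subtype.val (huniq ⟨s(φ.symm 0, φ.symm 1), h₀₁⟩ ⟨by simp, e₁.trans hce⟩))
  · exact d₂ (congrArg Subtype.val (huniq ⟨s(φ.symm 1, φ.symm 2), h₁₂⟩ ⟨by simp, e₂.trans hce⟩))

variable [Fintype V]

lemma CFColorable.card_sub_two_le_of_isNearStarOrP5 [DecidableRel G.Adj] [Nonempty V] {k : ℕ}
    (h : G.CFColorable k) (hG : G.IsNearStarOrP5) : Fintype.card V - 2 ≤ k := by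
  rcases hG with ⟨ht, hm⟩ | ⟨⟨φ⟩⟩
  · obtain ⟨v, hv⟩ := G.exists_maximal_degree_vertex
    rw [← hm, hv]
    exact h.degree_le_of_isAcyclic ht.isAcyclic v
  · rw [Fintype.card_congr φ.toEquiv, Fintype.card_fin]
    exact h.three_le_of_iso_pathGraph_five φ

/-- The graph is a path on four vertices: a chord `p₁p₃` or `p₀p₂` would create a dominating vertex,
and `p₀p₃` a four-cycle, whose complement is disconnected. -/
lemma isNearStarOrP5_of_card_eq_four [DecidableRel G.Adj] (hG : G.Connected) (hGc : Gᶜ.Connected)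
    (hn : Fintype.card V = 4) : G.IsNearStarOrP5 := by
  have : Nontrivial V := Fintype.one_lt_card_iff_nontrivial.mp (by omega)
  have hd := exists_not_adj_of_compl_connected hGc
  obtain ⟨p₀, p₁, p₂, p₃, hnd, h₀₁, h₁₂, h₂₃⟩ := exists_path_four hG hd (by omega)
  have hall : ∀ v, v = p₀ ∨ v = p₁ ∨ v = p₂ ∨ v = p₃ := by
    classical
    intro v
    by_contra! hv
    have := card_ge_of_nodup (l := [v, p₀, p₁, p₂, p₃])
      (List.nodup_cons.mpr ⟨by simpa using hv, hnd⟩)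
    simp at this
    omega
  have h₁₃ : ¬ G.Adj p₁ p₃ := fun h => by
    obtain ⟨w, hw, hw'⟩ := hd p₁
    rcases hall w with rfl | rfl | rfl | rfl
    exacts [hw' h₀₁.symm, hw rfl, hw' h₁₂, hw' h]
  have h₀₂ : ¬ G.Adj p₀ p₂ := fun h => by
    obtain ⟨w, hw, hw'⟩ := hd p₂
    rcases hall w with rfl | rfl | rfl | rfl
    exacts [hw' h.symm, hw' h₁₂.symm, hw rfl, hw' h₂₃]
  have h₀₃ : ¬ G.Adj p₀ p₃ := fun h => by
    obtain ⟨a, ha, b, hb, hab⟩ := hGc.exists_adj_boundary {p₀, p₂} (u := p₀) (v := p₁) (by simp)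
      (by simp at hnd ⊢; grind)
    rw [compl_adj] at hab
    simp only [Set.mem_insert_iff, Set.mem_singleton_iff, not_or] at ha hb
    have := h₀₁.symm; have := h₁₂.symm; have := h₂₃.symm; have := h.symm; have := hall b
    grind
  refine .inl (isTree_and_maxDegree_of_near_star hG hd (a := p₂) (b := p₃) (c := p₁)
    (by simp at hnd; grind) h₁₃ ?_ ?_)
  · intro y hyc hyb
    rcases hall y with rfl | rfl | rfl | rfl
    exacts [h₀₁.symm, absurd rfl hyc, h₁₂, absurd rfl hyb]
  · intro u w huw hu hw
    have := huw.symm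
    have := huw.ne
    rw [Sym2.eq_iff]
    have := hall u
    have := hall w
    grind

lemma cfColorable_card_sub_two (hG : G.Connected) (hGc : Gᶜ.Connected)
    (hn : 4 ≤ Fintype.card V) : G.CFColorable (Fintype.card V - 2) := by
  have : Nontrivial V := Fintype.one_lt_card_iff_nontrivial.mp (by omega)
  obtain ⟨p₀, p₁, p₂, p₃, hnd, h₀₁, h₁₂, h₂₃⟩ :=
    exists_path_four hG (exists_not_adj_of_compl_connected hGc) (by omega)
  rw [show Fintype.card V - 2 = 2 + (Fintype.card V - 4) by omega]
  exact cfColorable_of_path_four hG hnd h₀₁ h₁₂ h₂₃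

lemma two_le_cfcNumber (hG : G.Connected) (hGc : Gᶜ.Connected) (hn : 4 ≤ Fintype.card V) :
    2 ≤ G.cfcNumber := by
  have : Nontrivial V := Fintype.one_lt_card_iff_nontrivial.mp (by omega)
  obtain ⟨v⟩ := hG.nonempty
  obtain ⟨w, hw, hvw⟩ := exists_not_adj_of_compl_connected hGc v
  exact (cfColorable_card_sub_two hG hGc hn).cfColorable_cfcNumber.two_le hw.symm hvw

lemma cfcNumber_eq_card_sub_two_iff [DecidableRel G.Adj] (hG : G.Connected) (hGc : Gᶜ.Connected)
    (hn : 4 ≤ Fintype.card V) : G.cfcNumber = Fintype.card V - 2 ↔ G.IsNearStarOrP5 := by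
  have : Nontrivial V := Fintype.one_lt_card_iff_nontrivial.mp (by omega)
  have hcol := cfColorable_card_sub_two hG hGc hn
  refine ⟨fun h => ?_, fun h => le_antisymm hcol.cfcNumber_le
    (hcol.cfColorable_cfcNumber.card_sub_two_le_of_isNearStarOrP5 h)⟩
  rcases hn.eq_or_lt with h4 | h5
  · exact isNearStarOrP5_of_card_eq_four hG hGc h4.symm
  · by_contra hns
    have := (cfColorable_of_not_isNearStarOrP5 hG (exists_not_adj_of_compl_connected hGc) h5
      hns).cfcNumber_le
    omega

end LowerBounds

end SimpleGraph

namespace SimpleGraph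

/-! ### Growing a two-coloring along ears -/

section Ears

variable {V : Type*} {G : SimpleGraph V} {S S' : Set (Sym2 V)} {U U' : Set V} {k l : ℕ} {u v w : V}

open Classical in
/-- Two vertices are joined, inside `U`, by a path with exactly `k` edges in `S`. -/
def JoinedBy (G : SimpleGraph V) (S : Set (Sym2 V)) (U : Set V) (k : ℕ) (u v : V) : Prop :=
  ∃ p : G.Walk u v, p.IsPath ∧ (∀ x ∈ p.support, x ∈ U) ∧ p.edges.countP (· ∈ S) = k

lemma joinedBy_of_adj_of_notMem (h : G.Adj u v) (hS : s(u, v) ∉ S) (hu : u ∈ U) (hv : v ∈ U) :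
    G.JoinedBy S U 0 u v :=
  ⟨h.toWalk, h.isPath_toWalk, by simp [hu, hv], by simp [hS]⟩

lemma joinedBy_of_adj_of_mem (h : G.Adj u v) (hS : s(u, v) ∈ S) (hu : u ∈ U) (hv : v ∈ U) :
    G.JoinedBy S U 1 u v :=
  ⟨h.toWalk, h.isPath_toWalk, by simp [hu, hv], by simp [hS]⟩

lemma Walk.IsPath.joinedBy_zero {p : G.Walk u v} (hp : p.IsPath) (hS : ∀ e ∈ p.edges, e ∉ S) :
    G.JoinedBy S {x | x ∈ p.support} 0 u v :=
  ⟨p, hp, fun _ h => h, by simpa [List.countP_eq_zero] using hS⟩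

namespace JoinedBy

lemma symm (h : G.JoinedBy S U k u v) : G.JoinedBy S U k v u := by
  obtain ⟨p, hp, hU, hk⟩ := h
  exact ⟨p.reverse, hp.reverse, by simpa using hU, by simpa using hk⟩

lemma mono (h : G.JoinedBy S U k u v) (hU : U ⊆ U') : G.JoinedBy S U' k u v := by
  obtain ⟨p, hp, hpU, hk⟩ := h
  exact ⟨p, hp, fun x hx => hU (hpU x hx), hk⟩

lemma congr (h : G.JoinedBy S U k u v) (hS : ∀ e : Sym2 V, (∀ x ∈ e, x ∈ U) → (e ∈ S ↔ e ∈ S')) :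
    G.JoinedBy S' U k u v := by
  obtain ⟨p, hp, hpU, hk⟩ := h
  refine ⟨p, hp, hpU, hk ▸ List.countP_congr fun e he => ?_⟩
  simpa using (hS e fun x hx => hpU x (p.mem_support_of_mem_edges he hx)).symm

lemma trans (h : G.JoinedBy S U k u v) (h' : G.JoinedBy S U' l v w)
    (hUU' : ∀ x ∈ U, x ∈ U' → x = v) : G.JoinedBy S (U ∪ U') (k + l) u w := by
  obtain ⟨p, hp, hpU, hk⟩ := h
  obtain ⟨q, hq, hqU, hl⟩ := h'
  refine ⟨p.append q, ?_, ?_, by rw [Walk.edges_append, List.countP_append, hk, hl]⟩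
  · rw [Walk.isPath_def, Walk.support_append, List.nodup_append']
    refine ⟨hp.support_nodup, hq.support_nodup.tail, fun x hx hx' => ?_⟩
    obtain rfl := hUU' x (hpU x hx) (hqU x (List.mem_of_mem_tail hx'))
    have := hq.support_nodup
    rw [← Walk.cons_tail_support] at this
    exact (List.nodup_cons.mp this).1 hx'
  · intro x hx
    rw [Walk.mem_support_append_iff] at hx
    exact hx.imp (hpU x) (hqU x)

open Classical in
lemma linkedIn (h : G.JoinedBy S U 1 u v) :
    G.LinkedIn (fun e => if e ∈ S then 1 else 0) U u v := by
  obtain ⟨p, hp, hpU, hk⟩ := h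
  rw [List.countP_eq_length_filter, List.length_eq_one_iff] at hk
  obtain ⟨e, he⟩ := hk
  have hmem : ∀ e', e' ∈ p.edges ∧ e' ∈ S ↔ e' = e := fun e' => by
    rw [← List.mem_singleton, ← he, List.mem_filter]
    simp
  obtain ⟨hep, heS⟩ := (hmem e).mpr rfl
  refine ⟨p, hp, hpU, e, hep, fun e' he' hc => (hmem e').mp ⟨he', ?_⟩⟩
  by_contra h
  simp [heS, h] at hc

end JoinedBy

lemma Walk.IsPath.eq_of_mem_support_append {p : G.Walk u v} {q : G.Walk v w}
    (h : (p.append q).IsPath) {x : V} (hp : x ∈ p.support) (hq : x ∈ q.support) : x = v := by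
  by_contra hx
  exact h.ne_of_mem_support_of_append hx hp hq rfl

/-- Inside `U`, any two vertices are joined by a path avoiding `S`, and any two distinct ones by a
path with exactly one edge in `S`. -/
structure IsFlexible (G : SimpleGraph V) (S : Set (Sym2 V)) (U : Set V) : Prop where
  mem_of_mem : ∀ e ∈ S, ∀ x ∈ e, x ∈ U
  zero : ∀ u ∈ U, ∀ v ∈ U, G.JoinedBy S U 0 u v
  one : ∀ u ∈ U, ∀ v ∈ U, u ≠ v → G.JoinedBy S U 1 u v

lemma isFlexible_singleton (v : V) : G.IsFlexible ∅ {v} where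
  mem_of_mem := by simp
  zero := by
    rintro _ rfl _ rfl
    exact ⟨.nil, by simp, by simp, by simp⟩
  one := by
    rintro _ rfl _ rfl h
    exact absurd rfl h

/-- Stopping at the first visit to `U` and removing detours turns a returning walk into an ear. -/
lemma Walk.exists_path_to_set (U : Set V) {z x : V} (p : G.Walk z x) (hx : x ∈ U) :
    ∃ y ∈ U, ∃ q : G.Walk z y, q.IsPath ∧ (∀ t ∈ q.support, t ∈ U → t = y) ∧
      q.edges ⊆ p.edges := by
  classical
  suffices h : ∃ y ∈ U, ∃ q : G.Walk z y, (∀ t ∈ q.support, t ∈ U → t = y) ∧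
      q.edges ⊆ p.edges by
    obtain ⟨y, hy, q, hq, hqp⟩ := h
    exact ⟨y, hy, q.bypass, q.bypass_isPath, fun t ht => hq t (q.support_bypass_subset_support ht),
      fun e he => hqp (q.edges_bypass_subset_edges he)⟩
  induction p with
  | nil => exact ⟨_, hx, .nil, by simp, by simp⟩
  | @cons a b c hab p ih =>
    by_cases ha : a ∈ U
    · exact ⟨a, ha, .nil, by simp, by simp⟩
    · obtain ⟨y, hy, q, hq, hqp⟩ := ih hx
      refine ⟨y, hy, .cons hab q, ?_, ?_⟩
      · intro t ht htU
        rw [Walk.support_cons, List.mem_cons] at ht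
        rcases ht with rfl | ht
        · exact absurd htU ha
        · exact hq t ht htU
      · rw [Walk.edges_cons, Walk.edges_cons]
        exact List.cons_subset_cons _ hqp

/-- A flexible set can be enlarged along an ear. -/
lemma IsFlexible.exists_extension (h : G.IsFlexible S U) {x z : V} (hx : x ∈ U) (hz : z ∉ U)
    (hxz : G.Adj x z) (p : G.Walk z x) (hp : s(x, z) ∉ p.edges) :
    ∃ S' U', U ⊆ U' ∧ z ∈ U' ∧ G.IsFlexible S' U' := by
  classical
  obtain ⟨y, hy, q, hq, hqU, hqp⟩ := p.exists_path_to_set U hx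
  -- For a closed ear (`y = x`) the edge `xz` is marked. For an open ear nothing is, since `U`
  -- already contains a path from `x` to `y` with one marked edge. `ε` counts the marks on `xz`.
  set S' : Set (Sym2 V) := if x = y then insert s(x, z) S else S with hS'
  set ε : ℕ := if x = y then 1 else 0 with hε
  have hSS' : ∀ e ∈ S', e ∈ S ∨ e = s(x, z) := by
    intro e he
    rw [hS'] at he
    split_ifs at he
    exacts [he.symm, .inl he]
  have hagree : ∀ e : Sym2 V, (∀ t ∈ e, t ∈ U) → (e ∈ S ↔ e ∈ S') := by
    intro e he
    refine ⟨fun h => ?_, fun h => (hSS' e h).resolve_right ?_⟩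
    · rw [hS']; split_ifs
      exacts [.inr h, h]
    · rintro rfl
      exact hz (he z (by simp))
  -- An old marked edge has both ends in `U`, but `q` meets `U` only at `y`; and `q` avoids `xz`.
  have hqS : ∀ e ∈ q.edges, e ∉ S' := by
    intro e he heS
    rcases hSS' e heS with heS | rfl
    · induction e with
      | _ a b =>
        have ha := hqU a (q.fst_mem_support_of_mem_edges he) (h.mem_of_mem _ heS a (by simp))
        have hb := hqU b (q.snd_mem_support_of_mem_edges he) (h.mem_of_mem _ heS b (by simp))
        exact (q.adj_of_mem_edges he).ne (ha.trans hb.symm)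
    · exact hp (hqp he)
  have zero : ∀ u ∈ U, ∀ v ∈ U, G.JoinedBy S' U 0 u v :=
    fun u hu v hv => (h.zero u hu v hv).congr hagree
  have one : ∀ u ∈ U, ∀ v ∈ U, u ≠ v → G.JoinedBy S' U 1 u v :=
    fun u hu v hv huv => (h.one u hu v hv huv).congr hagree
  set W : Set V := U ∪ {t | t ∈ q.support} with hW
  have hUW : U ⊆ W := Set.subset_union_left
  have hqW : ∀ t ∈ q.support, t ∈ W := fun t ht => .inr ht
  have edge : G.JoinedBy S' {z, x} ε z x := by
    rw [hε]
    split_ifs with hxy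
    · exact joinedBy_of_adj_of_mem hxz.symm (by simp [hS', hxy, Sym2.eq_swap]) (by simp) (by simp)
    · refine joinedBy_of_adj_of_notMem hxz.symm ?_ (by simp) (by simp)
      rw [hS', if_neg hxy]
      exact fun hmem => hz (h.mem_of_mem _ hmem z (by simp))
  -- travelling backwards along the ear, to its other end `x`
  have back : ∀ (t : V) (a : G.Walk z t) (b : G.Walk t y), q = a.append b → t ∉ U →
      (∀ r ∈ a.support, r ∉ U) ∧ G.JoinedBy S' ({r | r ∈ a.support} ∪ {z, x}) ε t x := by
    intro t a b hab ht
    have haU : ∀ r ∈ a.support, r ∉ U := by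
      intro r hr hrU
      have hry := hqU r (by rw [hab, Walk.mem_support_append_iff]; exact .inl hr) hrU
      have := (hab ▸ hq).eq_of_mem_support_append hr (by rw [hry]; exact b.end_mem_support)
      exact ht (this ▸ hrU)
    refine ⟨haU, ?_⟩
    have ha := (hab ▸ hq).of_append_left.joinedBy_zero (S := S') fun e he => hqS e (by
      rw [hab, Walk.edges_append]; exact List.mem_append_left _ he)
    have := ha.symm.trans edge ?_
    · rwa [zero_add] at this
    · rintro r hr (rfl | rfl)
      · rfl
      · exact absurd hx (haU _ hr)
  have forth : ∀ (t : V) (a : G.Walk z t) (b : G.Walk t y), q = a.append b →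
      G.JoinedBy S' {r | r ∈ b.support} 0 t y := fun t a b hab =>
    (hab ▸ hq).of_append_right.joinedBy_zero (S := S') fun e he => hqS e (by
      rw [hab, Walk.edges_append]; exact List.mem_append_right _ he)
  have zero_in : ∀ t ∈ q.support, ∀ u ∈ U, G.JoinedBy S' W 0 t u := by
    intro t ht u hu
    obtain ⟨a, b, hab⟩ := q.mem_support_iff_exists_append.mp ht
    have hbq : ∀ r ∈ b.support, r ∈ q.support := fun r hr => by
      rw [hab, Walk.mem_support_append_iff]; exact .inr hr
    exact ((forth t a b hab).trans (zero y hy u hu) fun r hr hrU => hqU r (hbq r hr) hrU).mono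
      (Set.union_subset (fun r hr => hqW r (hbq r hr)) hUW)
  -- On a closed ear, go back through the marked edge `xz`, then unmarked through `U`. On an open
  -- one, go forward to `y` and cross one mark in `U`; if `u = y`, go back to `x` and cross `U` from
  -- there.
  have one_in : ∀ t ∈ q.support, t ∉ U → ∀ u ∈ U, G.JoinedBy S' W 1 t u := by
    intro t ht htU u hu
    obtain ⟨a, b, hab⟩ := q.mem_support_iff_exists_append.mp ht
    have hbq : ∀ r ∈ b.support, r ∈ q.support := fun r hr => by
      rw [hab, Walk.mem_support_append_iff]; exact .inr hr
    obtain ⟨haU, hback⟩ := back t a b hab htU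
    have haW : {r | r ∈ a.support} ∪ {z, x} ⊆ W := by
      rintro r (hr | rfl | rfl)
      · exact hqW r (by rw [hab, Walk.mem_support_append_iff]; exact .inl hr)
      · exact hqW _ q.start_mem_support
      · exact hUW hx
    have hdisj : ∀ r ∈ {r | r ∈ a.support} ∪ {z, x}, r ∈ U → r = x := by
      rintro r (hr | rfl | rfl) hrU
      exacts [absurd hrU (haU r hr), absurd hrU hz, rfl]
    by_cases hxy : x = y
    · have := (hback.trans (zero x hx u hu) hdisj).mono (Set.union_subset haW hUW)
      simpa [hε, hxy] using this
    · by_cases huy : y = u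
      · subst huy
        have := (hback.trans (one x hx y hy hxy) hdisj).mono (Set.union_subset haW hUW)
        simpa [hε, hxy] using this
      · have := ((forth t a b hab).trans (one y hy u hu huy)
          fun r hr hrU => hqU r (hbq r hr) hrU).mono
          (Set.union_subset (fun r hr => hqW r (hbq r hr)) hUW)
        simpa using this
  -- The ear segment from `t` to `t'` is unmarked. The other way round, back to `x`, through `U` to
  -- `y`, and back along the ear to `t'`, has exactly one mark.
  have between : ∀ (t t' : V) (a : G.Walk z t) (m : G.Walk t t') (d : G.Walk t' y),
      q = a.append (m.append d) → t ∉ U → t ≠ t' →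
      G.JoinedBy S' W 0 t t' ∧ G.JoinedBy S' W 1 t t' := by
    intro t t' a m d hamd ht htt'
    have hq' : (a.append (m.append d)).IsPath := hamd ▸ hq
    have hmd := hq'.of_append_right
    have hsub : ∀ r, r ∈ a.support ∨ r ∈ m.support ∨ r ∈ d.support → r ∈ q.support := by
      intro r hr
      rwa [hamd, Walk.mem_support_append_iff, Walk.mem_support_append_iff]
    obtain ⟨haU, hback⟩ := back t a (m.append d) hamd ht
    have hd : G.JoinedBy S' {r | r ∈ d.support} 0 y t' :=
      (forth t' (a.append m) d (by rw [hamd, Walk.append_assoc])).symm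
    have had : ∀ r ∈ a.support, r ∉ d.support := by
      intro r hra hrd
      have h₁ := hq'.eq_of_mem_support_append hra
        (by rw [Walk.mem_support_append_iff]; exact .inr hrd)
      subst h₁
      exact htt' (hmd.eq_of_mem_support_append m.start_mem_support hrd)
    have hzx : ∀ r ∈ {r | r ∈ a.support} ∪ {z, x}, r ∈ W ∧ (r ∈ U → r = x) ∧
        (r ∈ d.support → r = x) := by
      rintro r (hr | rfl | rfl)
      · exact ⟨hqW r (hsub r (.inl hr)), fun h => absurd h (haU r hr), fun h => absurd h (had r hr)⟩
      · exact ⟨hqW _ q.start_mem_support, fun h => absurd h hz,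
          fun h => absurd h (had _ a.start_mem_support)⟩
      · exact ⟨hUW hx, fun _ => rfl, fun _ => rfl⟩
    refine ⟨(hmd.of_append_left.joinedBy_zero fun e he => hqS e ?_).mono
      fun r hr => hqW r (hsub r (.inr (.inl hr))), ?_⟩
    · rw [hamd, Walk.edges_append, Walk.edges_append]
      exact List.mem_append_right _ (List.mem_append_left _ he)
    · by_cases hxy : x = y
      · subst hxy
        have := (hback.trans hd fun r hr hrd => (hzx r hr).2.2 hrd).mono
          (U' := W) (Set.union_subset (fun r hr => (hzx r hr).1)
            fun r hr => hqW r (hsub r (.inr (.inr hr))))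
        simpa [hε] using this
      · have h₁ := hback.trans (one x hx y hy hxy) fun r hr hrU => (hzx r hr).2.1 hrU
        have := (h₁.trans hd ?_).mono (U' := W) (Set.union_subset (Set.union_subset
          (fun r hr => (hzx r hr).1) hUW) fun r hr => hqW r (hsub r (.inr (.inr hr))))
        · simpa [hε, hxy] using this
        · rintro r (hr | hr) hrd
          · have hrx := (hzx r hr).2.2 hrd
            subst hrx
            exact hqU r (hsub r (.inr (.inr hrd))) hx
          · exact hqU r (hsub r (.inr (.inr hrd))) hr
  have both : ∀ t ∈ q.support, ∀ t' ∈ q.support, t ∉ U → t' ∉ U → t ≠ t' →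
      G.JoinedBy S' W 0 t t' ∧ G.JoinedBy S' W 1 t t' := by
    intro t ht t' ht' htU ht'U htt'
    obtain ⟨a, b, hab⟩ := q.mem_support_iff_exists_append.mp ht
    rw [hab, Walk.mem_support_append_iff] at ht'
    rcases ht' with ht' | ht'
    · obtain ⟨a', m, rfl⟩ := a.mem_support_iff_exists_append.mp ht'
      have := between t' t a' m b (by rw [hab, Walk.append_assoc]) ht'U htt'.symm
      exact ⟨this.1.symm, this.2.symm⟩
    · obtain ⟨m, d, rfl⟩ := b.mem_support_iff_exists_append.mp ht'
      exact between t t' a m d hab htU htt'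
  refine ⟨S', W, hUW, hqW z q.start_mem_support, ?_, ?_, ?_⟩
  · intro e he r hr
    rcases hSS' e he with he | rfl
    · exact hUW (h.mem_of_mem e he r hr)
    · rw [Sym2.mem_iff] at hr
      rcases hr with rfl | rfl
      exacts [hUW hx, hqW _ q.start_mem_support]
  · rintro u hu v hv
    by_cases huU : u ∈ U
    · by_cases hvU : v ∈ U
      · exact (zero u huU v hvU).mono hUW
      · exact (zero_in v (hv.resolve_left hvU) u huU).symm
    · have huq := hu.resolve_left huU
      by_cases hvU : v ∈ U
      · exact zero_in u huq v hvU
      · by_cases huv : u = v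
        · subst huv
          exact ⟨.nil, by simp, by simpa using hu, by simp⟩
        · exact (both u huq v (hv.resolve_left hvU) huU hvU huv).1
  · rintro u hu v hv huv
    by_cases huU : u ∈ U
    · by_cases hvU : v ∈ U
      · exact (one u huU v hvU huv).mono hUW
      · exact (one_in v (hv.resolve_left hvU) hvU u huU).symm
    · have huq := hu.resolve_left huU
      by_cases hvU : v ∈ U
      · exact one_in u huq huU v hvU
      · exact (both u huq v (hv.resolve_left hvU) huU hvU huv).2

end Ears

end SimpleGraph

namespace SimpleGraph

/-! ### A graph or its complement needs only two colors -/

section TwoColors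

variable {V : Type*} {G : SimpleGraph V}

lemma CFColorable.connected [Nonempty V] {k : ℕ} (h : G.CFColorable k) : G.Connected := by
  obtain ⟨c, hc⟩ := h
  refine ⟨fun u v => ?_⟩
  by_cases huv : u = v
  · exact huv ▸ Reachable.refl u
  · exact ⟨(hc u v huv).choose⟩

open Classical in
/-- The coloring that distinguishes a single edge. -/
noncomputable def singleColor (e : Sym2 V) : Sym2 V → ℕ := fun e' => if e' = e then 1 else 0

lemma CFColorable.of_singleColor (e : Sym2 V)
    (h : ∀ u v, u ≠ v → G.LinkedIn (singleColor e) Set.univ u v) : G.CFColorable 2 :=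
  .of_linkedIn _ (fun e' => by unfold singleColor; split_ifs <;> norm_num) h

/-- Only `e` has color 1, so every path through `e` is conflict-free. -/
lemma linkedIn_singleColor_of_list {e : Sym2 V} (l : List V) {u v : V} (hu : l.head? = some u)
    (hv : l.getLast? = some v) (hnd : l.Nodup) (hl : ∀ e ∈ pairs l, e ∈ G.edgeSet)
    (he : e ∈ pairs l) : G.LinkedIn (singleColor e) Set.univ u v := by
  obtain ⟨p, hp, -, hpe⟩ := exists_path_of_list l hu hv hnd hl
  refine ⟨p, hp, fun _ _ => trivial, e, hpe ▸ he, fun e' _ hc => ?_⟩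
  by_contra hne
  simp [singleColor, hne] at hc

lemma cfColorable_two_of_dominating_edge {p q : V} (hpq : G.Adj p q)
    (h₁ : ∀ x, x ≠ p → x ≠ q → G.Adj x p ∨ G.Adj x q)
    (h₂ : ∀ x y, x ≠ p → x ≠ q → y ≠ p → y ≠ q → x ≠ y →
      G.Adj x p ∧ G.Adj y q ∨ G.Adj x q ∧ G.Adj y p) : G.CFColorable 2 := by
  have hne := hpq.ne
  have hp : ∀ x, x ≠ p → G.LinkedIn (singleColor s(p, q)) Set.univ p x := by
    intro x hxp
    by_cases hxq : x = q
    · exact linkedIn_of_adj (hxq ▸ hpq) trivial trivial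
    · rcases h₁ x hxp hxq with h | h
      · exact linkedIn_of_adj h.symm trivial trivial
      · exact linkedIn_singleColor_of_list [p, q, x] rfl rfl (by simp; grind)
          (by simp [pairs, hpq, h.symm]) (by simp [pairs])
  have hq : ∀ x, x ≠ q → G.LinkedIn (singleColor s(p, q)) Set.univ q x := by
    intro x hxq
    by_cases hxp : x = p
    · exact linkedIn_of_adj (hxp ▸ hpq.symm) trivial trivial
    · rcases h₁ x hxp hxq with h | h
      · exact linkedIn_singleColor_of_list [q, p, x] rfl rfl (by simp; grind)
          (by simp [pairs, hpq.symm, h.symm]) (by simp [pairs, Sym2.eq_swap])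
      · exact linkedIn_of_adj h.symm trivial trivial
  refine .of_singleColor s(p, q) fun x y hxy => ?_
  by_cases hxp : x = p
  · exact hxp ▸ hp y (hxp ▸ hxy.symm)
  by_cases hxq : x = q
  · exact hxq ▸ hq y (hxq ▸ hxy.symm)
  by_cases hyp : y = p
  · rw [hyp]; exact (hp x hxp).symm
  by_cases hyq : y = q
  · rw [hyq]; exact (hq x hxq).symm
  rcases h₂ x y hxp hxq hyp hyq hxy with ⟨hx, hy⟩ | ⟨hx, hy⟩
  · exact linkedIn_singleColor_of_list [x, p, q, y] rfl rfl (by simp; grind)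
      (by simp [pairs, hx, hpq, hy.symm]) (by simp [pairs])
  · exact linkedIn_singleColor_of_list [x, q, p, y] rfl rfl (by simp; grind)
      (by simp [pairs, hx, hpq.symm, hy.symm]) (by simp [pairs, Sym2.eq_swap])

/-- All pairs other than those with `u` are adjacent or joined through `pq`; `u` first steps to `w`
and then behaves like the rest. -/
lemma cfColorable_two_of_adj_all_but_one {p q u w : V} (hpq : G.Adj p q) (hup : u ≠ p)
    (huq : u ≠ q) (hwp : w ≠ p) (hwq : w ≠ q) (huw : G.Adj u w)
    (h : ∀ x, x ≠ p → x ≠ q → x ≠ u → G.Adj x p ∧ G.Adj x q) : G.CFColorable 2 := by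
  have hne := hpq.ne
  have hwu := huw.ne
  obtain ⟨hwp', hwq'⟩ := h w hwp hwq hwu.symm
  have hu : ∀ x, x ≠ u → G.LinkedIn (singleColor s(p, q)) Set.univ u x := by
    intro x hxu
    by_cases hxw : x = w
    · exact linkedIn_of_adj (hxw ▸ huw) trivial trivial
    by_cases hxp : x = p
    · subst hxp
      exact linkedIn_singleColor_of_list [u, w, q, x] rfl rfl (by simp; grind)
        (by simp [pairs, huw, hwq', hpq.symm]) (by simp [pairs, Sym2.eq_swap])
    by_cases hxq : x = q
    · subst hxq
      exact linkedIn_singleColor_of_list [u, w, p, x] rfl rfl (by simp; grind)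
        (by simp [pairs, huw, hwp', hpq]) (by simp [pairs])
    · exact linkedIn_singleColor_of_list [u, w, p, q, x] rfl rfl (by simp; grind)
        (by simp [pairs, huw, hwp', hpq, (h x hxp hxq hxu).2.symm]) (by simp [pairs])
  refine .of_singleColor s(p, q) fun x y hxy => ?_
  by_cases hxu : x = u
  · exact hxu ▸ hu y (hxu ▸ hxy.symm)
  by_cases hyu : y = u
  · rw [hyu]; exact (hu x hxu).symm
  by_cases hx : x = p ∨ x = q
  · by_cases hy : y = p ∨ y = q
    · refine linkedIn_of_adj ?_ trivial trivial
      have := hpq.symm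
      grind
    · rw [not_or] at hy
      have := h y hy.1 hy.2 hyu
      refine linkedIn_of_adj ?_ trivial trivial
      rcases hx with rfl | rfl
      exacts [this.1.symm, this.2.symm]
  · rw [not_or] at hx
    obtain ⟨hxp, hxq⟩ := h x hx.1 hx.2 hxu
    by_cases hy : y = p ∨ y = q
    · refine linkedIn_of_adj ?_ trivial trivial
      rcases hy with rfl | rfl
      exacts [hxp, hxq]
    · rw [not_or] at hy
      exact linkedIn_singleColor_of_list [x, p, q, y] rfl rfl (by simp; grind)
        (by simp [pairs, hxp, hpq, (h y hy.1 hy.2 hyu).2.symm]) (by simp [pairs])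

/-- Two vertices on one side are joined by `a, v', u', v, b`. Only the last edge can be the missing
one, and since at most one of the two is `u`, the path can be oriented to avoid it. -/
lemma linkedIn_of_almost_complete_bipartite {A : Set V} {u v u' v' : V} (hv : v ∉ A)
    (hu' : u' ∈ A) (hv' : v' ∉ A) (hne : u' ≠ u) (hne' : v' ≠ v)
    (h : ∀ a ∈ A, ∀ b ∉ A, ¬ (a = u ∧ b = v) → G.Adj a b) {x y : V} (hx : x ∈ A) (hy : y ∈ A)
    (hxy : x ≠ y) : G.LinkedIn (singleColor s(u', v')) Set.univ x y := by
  have hAv' : ∀ a ∈ A, G.Adj a v' := fun a ha => h a ha v' hv' fun h => hne' h.2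
  have hu'v : G.Adj u' v := h u' hu' v hv fun h => hne h.1
  have hu'v' := hAv' u' hu'
  have from_u' : ∀ a ∈ A, a ≠ u' → G.LinkedIn (singleColor s(u', v')) Set.univ u' a :=
    fun a ha hau' => linkedIn_singleColor_of_list [u', v', a] rfl rfl
      (by simp; grind) (by simp [pairs, hu'v', (hAv' a ha).symm]) (by simp [pairs])
  have main : ∀ a ∈ A, ∀ b ∈ A, a ≠ b → a ≠ u' → b ≠ u' → b ≠ u →
      G.LinkedIn (singleColor s(u', v')) Set.univ a b := fun a ha b hb hab hau' hbu' hbu =>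
    linkedIn_singleColor_of_list [a, v', u', v, b] rfl rfl (by simp; grind)
      (by simp [pairs, hAv' a ha, hu'v'.symm, hu'v, (h b hb v hv fun h => hbu h.1).symm])
      (by simp [pairs, Sym2.eq_swap])
  by_cases hxu' : x = u'
  · exact hxu' ▸ from_u' y hy (hxu' ▸ hxy.symm)
  by_cases hyu' : y = u'
  · rw [hyu']; exact (from_u' x hx hxu').symm
  by_cases hyu : y = u
  · exact (main y hy x hx hxy.symm hyu' hxu' (hyu ▸ hxy)).symm
  · exact main x hx y hy hxy hxu' hyu' hyu

lemma cfColorable_two_of_almost_complete_bipartite {A : Set V} {u v u' v' : V} (hu : u ∈ A)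
    (hv : v ∉ A) (hu' : u' ∈ A) (hv' : v' ∉ A) (hne : u' ≠ u) (hne' : v' ≠ v)
    (h : ∀ a ∈ A, ∀ b ∉ A, ¬ (a = u ∧ b = v) → G.Adj a b) : G.CFColorable 2 := by
  have across : ∀ x ∈ A, ∀ y ∉ A, G.LinkedIn (singleColor s(u', v')) Set.univ x y := by
    intro x hx y hy
    by_cases hxy : x = u ∧ y = v
    · obtain ⟨rfl, rfl⟩ := hxy
      have h₁ := h x hx v' hv' fun h => hne' h.2
      have h₂ := h u' hu' v' hv' fun h => hne' h.2
      have h₃ := h u' hu' y hv fun h => hne h.1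
      exact linkedIn_singleColor_of_list [x, v', u', y] rfl rfl (by simp; grind)
        (by simp [pairs, h₁, h₂.symm, h₃]) (by simp [pairs, Sym2.eq_swap])
    · exact linkedIn_of_adj (h x hx y hy hxy) trivial trivial
  refine .of_singleColor s(u', v') fun x y hxy => ?_
  by_cases hx : x ∈ A
  · by_cases hy : y ∈ A
    · exact linkedIn_of_almost_complete_bipartite hv hu' hv' hne hne' h hx hy hxy
    · exact across x hx y hy
  · by_cases hy : y ∈ A
    · exact (across y hy x hx).symm
    · rw [Sym2.eq_swap]
      exact linkedIn_of_almost_complete_bipartite (A := Aᶜ) (v := u) (u := v) (by simpa using hu)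
        hv' (by simpa using hu') hne' hne
        (fun a ha b hb hab => (h b (by simpa using hb) a ha fun h => hab h.symm).symm) hx hy hxy

/-- The last condition says that every edge leaving `U` is a bridge: any other would start an ear
enlarging `U`. -/
lemma exists_maximal_isFlexible [Finite V] (r : V) : ∃ S U, r ∈ U ∧ G.IsFlexible S U ∧
    ∀ x ∈ U, ∀ z ∉ U, G.Adj x z → ∀ p : G.Walk z x, s(x, z) ∈ p.edges := by
  obtain ⟨U, ⟨hr, S, hS⟩, hmax⟩ :=
    (Set.toFinite {U : Set V | r ∈ U ∧ ∃ S, G.IsFlexible S U}).exists_maximal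
    ⟨{r}, rfl, ∅, isFlexible_singleton r⟩
  refine ⟨S, U, hr, hS, fun x hx z hz hxz p => ?_⟩
  by_contra hp
  obtain ⟨S', U', hUU', hzU', hS'⟩ := hS.exists_extension hx hz hxz p hp
  exact hz (hmax ⟨hUU' hr, S', hS'⟩ hUU' hzU')

/-- A connected graph with at most one bridge, this bridge being pendant. -/
lemma cfColorable_two_of_unique_leaf [Finite V] (hG : G.Connected)
    (hB : ∀ x z, G.Adj x z → (∀ p : G.Walk z x, s(x, z) ∈ p.edges) →
      (∀ t, G.Adj x t ↔ t = z) ∨ (∀ t, G.Adj z t ↔ t = x))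
    (hL : ∀ v u v' u', (∀ t, G.Adj v t ↔ t = u) → (∀ t, G.Adj v' t ↔ t = u') → v = v') :
    G.CFColorable 2 := by
  classical
  -- Starting from the neighbor of the leaf, if there is one, ensures that a bridge leaving `U` has
  -- its leaf outside `U`.
  obtain ⟨r, hr⟩ : ∃ r, ∀ v u, (∀ t, G.Adj v t ↔ t = u) → u = r := by
    by_cases h : ∃ v u, ∀ t, G.Adj v t ↔ t = u
    · obtain ⟨v, u, hvu⟩ := h
      refine ⟨u, fun v' u' h' => ?_⟩
      obtain rfl := hL _ _ _ _ hvu h'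
      exact (hvu u').mp ((h' u').mpr rfl)
    · exact ⟨hG.nonempty.some, fun v u hvu => absurd ⟨v, u, hvu⟩ h⟩
  obtain ⟨S, U, hrU, hS, hmax⟩ := G.exists_maximal_isFlexible r
  have hleaf : ∀ x ∈ U, ∀ z ∉ U, G.Adj x z → ∀ t, G.Adj z t ↔ t = x := by
    intro x hx z hz hxz
    refine (hB x z hxz (hmax x hx z hz hxz)).resolve_left fun h => hz ?_
    rwa [hr _ _ h]
  have huniv : ∀ W : Set V, r ∈ W → (∀ a ∈ W, ∀ b ∉ W, ¬ G.Adj a b) → ∀ x, x ∈ W := by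
    intro W hrW hW x
    by_contra hx
    obtain ⟨a, ha, b, hb, hab⟩ := hG.exists_adj_boundary W hrW hx
    exact hW a ha b hb hab
  refine .of_linkedIn (fun e => if e ∈ S then 1 else 0) (fun e => by split_ifs <;> norm_num) ?_
  by_cases hU : ∃ x ∈ U, ∃ z ∉ U, G.Adj x z
  · obtain ⟨x, hx, z, hz, hxz⟩ := hU
    have hzx := hleaf x hx z hz hxz
    have hall : ∀ t, t = z ∨ t ∈ U := by
      refine huniv (insert z U) (.inr hrU) ?_
      rintro a (rfl | ha) b hb hab
      · rw [hzx] at hab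
        exact hb (.inr (hab ▸ hx))
      · have hbU : b ∉ U := fun h => hb (.inr h)
        exact hb (.inl (hL _ _ _ _ (hleaf a ha b hbU hab) hzx))
    have hz' : ∀ t ∈ U, G.LinkedIn (fun e => if e ∈ S then 1 else 0) Set.univ z t := by
      intro t ht
      by_cases htx : x = t
      · exact linkedIn_of_adj (htx ▸ hxz.symm) trivial trivial
      · have h₀ : G.JoinedBy S {z, x} 0 z x := joinedBy_of_adj_of_notMem hxz.symm
          (fun h => hz (hS.mem_of_mem _ h z (by simp))) (by simp) (by simp)
        have := (h₀.trans (hS.one x hx t ht htx) ?_).mono (Set.subset_univ _)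
        · rw [zero_add] at this
          exact this.linkedIn
        · rintro s (rfl | rfl) hs
          exacts [absurd hs hz, rfl]
    intro a b hab
    rcases hall a with rfl | ha
    · exact hz' b ((hall b).resolve_left hab.symm)
    · rcases hall b with rfl | hb
      · exact (hz' a ha).symm
      · exact ((hS.one a ha b hb hab).mono (Set.subset_univ _)).linkedIn
  · push Not at hU
    have hall := huniv U hrU hU
    exact fun a b hab => ((hS.one a (hall a) b (hall b) hab).mono (Set.subset_univ _)).linkedIn

/-- In the complement the two leaves are adjacent, and each misses only its former neighbor. Equal
neighbors leave one exceptional vertex; distinct ones leave two, attached at opposite ends of the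
edge. -/
lemma compl_cfColorable_two_of_leaves [Fintype V] (hG : G.Connected) (hGc : Gᶜ.Connected)
    (hn : 3 ≤ Fintype.card V) {v u v' u' : V} (hv : ∀ t, G.Adj v t ↔ t = u)
    (hv' : ∀ t, G.Adj v' t ↔ t = u') (hne : v ≠ v') : Gᶜ.CFColorable 2 := by
  have : Nontrivial V := ⟨v, v', hne⟩
  have hvu : G.Adj v u := (hv u).mpr rfl
  have hvu' : G.Adj v' u' := (hv' u').mpr rfl
  have hvv' : ¬ G.Adj v v' := by
    intro h
    obtain ⟨t, ht⟩ := exists_notMem_of_length_lt [v, v'] (by simp; omega)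
    obtain ⟨a, ha, b, hb, hab⟩ := hG.exists_adj_boundary {v, v'} (u := v) (v := t) (by simp)
      (by simpa using ht)
    have h₁ := (hv v').mp h
    have h₂ := (hv' v).mp h.symm
    rcases ha with rfl | rfl
    · exact hb (.inr (((hv b).mp hab).trans h₁.symm))
    · exact hb (.inl (((hv' b).mp hab).trans h₂.symm))
  have hc : Gᶜ.Adj v v' := by rw [compl_adj]; exact ⟨hne, hvv'⟩
  have hadj : ∀ x, x ≠ v → x ≠ u → Gᶜ.Adj x v := fun x h₁ h₂ => by
    rw [compl_adj, G.adj_comm, hv]; exact ⟨h₁, h₂⟩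
  have hadj' : ∀ x, x ≠ v' → x ≠ u' → Gᶜ.Adj x v' := fun x h₁ h₂ => by
    rw [compl_adj, G.adj_comm, hv']; exact ⟨h₁, h₂⟩
  by_cases huu' : u = u'
  · subst huu'
    obtain ⟨w, hw, huw⟩ := exists_not_adj_of_compl_connected hGc u
    exact cfColorable_two_of_adj_all_but_one (u := u) (w := w) hc hvu.ne' hvu'.ne'
      (by rintro rfl; exact huw hvu.symm) (by rintro rfl; exact huw hvu'.symm)
      (by rw [compl_adj]; exact ⟨hw.symm, huw⟩)
      fun x h₁ h₂ h₃ => ⟨hadj x h₁ h₃, hadj' x h₂ h₃⟩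
  · refine cfColorable_two_of_dominating_edge hc (fun x h₁ h₂ => ?_) fun x y h₁ h₂ h₃ h₄ h₅ => ?_
    · by_cases hxu : x = u
      · exact .inr (hadj' x h₂ (hxu ▸ huu'))
      · exact .inl (hadj x h₁ hxu)
    · have := hadj x h₁; have := hadj' x h₂; have := hadj y h₃; have := hadj' y h₄
      grind

lemma cfColorable_two_or_compl [Fintype V] (hG : G.Connected) (hGc : Gᶜ.Connected)
    (hn : 4 ≤ Fintype.card V) : G.CFColorable 2 ∨ Gᶜ.CFColorable 2 := by
  by_contra! hcon
  obtain ⟨hcol, hcolc⟩ := hcon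
  refine hcol (cfColorable_two_of_unique_leaf hG ?_ ?_)
  · intro x z hxz hbr
    -- This is the side of `x` once the bridge `xz` is deleted. If neither end of the bridge is a
    -- leaf, both sides contain a further vertex.
    set A : Set V := {t | ∃ p : G.Walk t x, s(x, z) ∉ p.edges} with hA
    have hx : x ∈ A := ⟨.nil, by simp⟩
    have hz : z ∉ A := fun ⟨p, hp⟩ => hp (hbr p)
    have hcross : ∀ a ∈ A, ∀ b ∉ A, G.Adj a b → a = x ∧ b = z := by
      rintro a ⟨p, hp⟩ b hb hab
      have : s(x, z) ∈ (Walk.cons hab.symm p).edges := by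
        by_contra h
        exact hb ⟨_, h⟩
      rw [Walk.edges_cons, List.mem_cons] at this
      rcases Sym2.eq_iff.mp (this.resolve_right hp) with ⟨rfl, rfl⟩ | ⟨rfl, rfl⟩
      · exact absurd hx hb
      · exact ⟨rfl, rfl⟩
    by_contra! h
    obtain ⟨⟨s, hs⟩, t, ht⟩ := h
    obtain ⟨u', hu', hu'x⟩ : ∃ u' ∈ A, u' ≠ x := by
      by_contra! hAx
      have hs' : G.Adj x s ↔ s = z := by
        refine ⟨fun h => ?_, fun h => h ▸ hxz⟩
        by_cases hsA : s ∈ A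
        · exact absurd (hAx s hsA) h.ne'
        · exact (hcross x hx s hsA h).2
      grind
    obtain ⟨v', hv', hv'z⟩ : ∃ v' ∉ A, v' ≠ z := by
      by_contra! hAz
      have ht' : G.Adj z t ↔ t = x := by
        refine ⟨fun h => ?_, fun h => h ▸ hxz.symm⟩
        by_cases htA : t ∈ A
        · exact (hcross t htA z hz h.symm).1
        · exact absurd (hAz t htA) h.ne'
      grind
    refine hcolc (cfColorable_two_of_almost_complete_bipartite hx hz hu' hv' hu'x hv'z
      fun a ha b hb hab => ?_)
    rw [compl_adj]
    exact ⟨by rintro rfl; exact hb ha, fun h => hab (hcross a ha b hb h)⟩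
  · intro v u v' u' hv hv'
    by_contra hne
    exact hcolc (compl_cfColorable_two_of_leaves hG hGc (by omega) hv hv' hne)

lemma cfcNumber_eq_two_or_compl [Fintype V] (hG : G.Connected) (hGc : Gᶜ.Connected)
    (hn : 4 ≤ Fintype.card V) : G.cfcNumber = 2 ∨ Gᶜ.cfcNumber = 2 :=
  (cfColorable_two_or_compl hG hGc hn).imp
    (fun h => le_antisymm h.cfcNumber_le (two_le_cfcNumber hG hGc hn))
    fun h => le_antisymm h.cfcNumber_le
      (two_le_cfcNumber hGc ((compl_compl G).symm ▸ hG) hn)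

end TwoColors

/-! ### Sharpness of the lower bounds, and the theorem -/

/-- The path `0 - 1 - 2 - 3` together with further vertices adjacent to exactly `1` and `2`. -/
def thickPathFour (n : ℕ) : SimpleGraph (Fin n) :=
  fromRel fun i j => i.val = 1 ∧ (j.val = 0 ∨ j.val = 2 ∨ 4 ≤ j.val) ∨
    i.val = 2 ∧ (j.val = 3 ∨ 4 ≤ j.val)

lemma thickPathFour_cfColorable {n : ℕ} (hn : 4 ≤ n) : (thickPathFour n).CFColorable 2 := by
  refine cfColorable_two_of_dominating_edge (p := ⟨1, by omega⟩) (q := ⟨2, by omega⟩) ?_ ?_ ?_ <;>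
    simp only [thickPathFour, fromRel_adj, ne_eq, Fin.ext_iff] <;> intros <;> grind

/-- In the complement, `03` is an edge, `2` is attached to `0`, `1` to `3`, and all further vertices
to both. -/
lemma compl_thickPathFour_cfColorable {n : ℕ} (hn : 4 ≤ n) :
    (thickPathFour n)ᶜ.CFColorable 2 := by
  refine cfColorable_two_of_dominating_edge (p := ⟨0, by omega⟩) (q := ⟨3, by omega⟩) ?_ ?_ ?_ <;>
    simp only [thickPathFour, compl_adj, fromRel_adj, ne_eq, Fin.ext_iff] <;> intros <;> grind

end SimpleGraph

theorem theorem5p1 (n : ℕ) (hn : 4 ≤ n) :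
    (∀ (V : Type*) [Fintype V] [DecidableEq V] (G : SimpleGraph V) [DecidableRel G.Adj],
      Fintype.card V = n → G.Connected → Gᶜ.Connected →
        (4 ≤ G.cfcNumber + Gᶜ.cfcNumber ∧ G.cfcNumber + Gᶜ.cfcNumber ≤ n) ∧
        (4 ≤ G.cfcNumber * Gᶜ.cfcNumber ∧ G.cfcNumber * Gᶜ.cfcNumber ≤ 2 * (n - 2)) ∧
        (G.cfcNumber + Gᶜ.cfcNumber = n ↔ G.IsNearStarOrP5 ∨ Gᶜ.IsNearStarOrP5) ∧
        (G.cfcNumber * Gᶜ.cfcNumber = 2 * (n - 2) ↔ G.IsNearStarOrP5 ∨ Gᶜ.IsNearStarOrP5)) ∧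
    (∃ G : SimpleGraph (Fin n), G.Connected ∧ Gᶜ.Connected ∧
      G.cfcNumber + Gᶜ.cfcNumber = 4 ∧ G.cfcNumber * Gᶜ.cfcNumber = 4) := by
  open SimpleGraph in
  constructor
  · rintro V _ _ G _ rfl hG hGc
    have hGcc : Gᶜᶜ.Connected := (compl_compl G).symm ▸ hG
    have h₁ := two_le_cfcNumber hG hGc hn
    have h₂ := two_le_cfcNumber hGc hGcc hn
    have h₃ := (cfColorable_card_sub_two hG hGc hn).cfcNumber_le
    have h₄ := (cfColorable_card_sub_two hGc hGcc hn).cfcNumber_le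
    rw [← cfcNumber_eq_card_sub_two_iff hG hGc hn, ← cfcNumber_eq_card_sub_two_iff hGc hGcc hn]
    -- With one factor equal to 2, all claims become linear in the other number. If the extremal
    -- graph is the one with number 2, then `n = 4` and the other number is also 2.
    rcases cfcNumber_eq_two_or_compl hG hGc hn with h | h <;> rw [h] at * <;>
      refine ⟨⟨?_, ?_⟩, ⟨?_, ?_⟩, ?_, ?_⟩ <;> omega
  · have : Nonempty (Fin n) := ⟨⟨0, by omega⟩⟩
    have h := thickPathFour_cfColorable hn
    have hc := compl_thickPathFour_cfColorable hn
    have hcard : 4 ≤ Fintype.card (Fin n) := by simpa using hn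
    have h₁ : (thickPathFour n).cfcNumber = 2 :=
      le_antisymm h.cfcNumber_le (two_le_cfcNumber h.connected hc.connected hcard)
    have h₂ : (thickPathFour n)ᶜ.cfcNumber = 2 := le_antisymm hc.cfcNumber_le
      (two_le_cfcNumber hc.connected ((compl_compl (thickPathFour n)).symm ▸ h.connected) hcard)
    exact ⟨thickPathFour n, h.connected, hc.connected, by rw [h₁, h₂], by rw [h₁, h₂]⟩
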